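/- For a von Neumann algebra $\mathcal M$ acting on a complex Hilbert space, let $\mathcal P(\mathcal M)$ be its set of projections, ordered as operators and with orthocomplement $P\mapsto 1-P$; it is a complete orthomodular lattice. Isomorphisms of complete orthomodular lattices are the bijections preserving arbitrary joins, arbitrary meets and orthocomplements. Let $\mathcal M_{part}$ be the set of normal operators in $\mathcal M$, with the involution of $\mathcal M$ and with addition and multiplication defined for commuting pairs only. A morphism $T:\mathcal M_{part}\to\mathcal N_{part}$ of partial von Neumann algebras is a unital map which is ultraweakly continuous on ultraweakly closed commuting subsets and satisfies $T(aA+bB)=aT(A)+bT(B)$, $T(AB)=T(A)T(B)$, $T(A^*)=T(A)^*$ for all commuting $A,B\in\mathcal M_{part}$ and $a,b\in\mathbb C$; an isomorphism is a bijection $T$ such that $T$ and $T^{-1}$ are morphisms. **Proposition.** Let $\mathcal M,\mathcal N$ be von Neumann algebras. There is a bijection between the isomorphisms $T:\mathcal M_{part}\to\mathcal N_{part}$ of partial von Neumann algebras and the isomorphisms $\tilde T:\mathcal P(\mathcal M)\to\mathcal P(\mathcal N)$ of complete orthomodular lattices. It sends $T$ to its restriction $\tilde T=T|_{\mathcal P(\mathcal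 M)}$. Its inverse sends $\tilde T$ to the map $T$ for which: 1. $T\big(\sum_{i=1}^n a_iP_i\big)=\sum_{i=1}^n a_i\tilde T(P_i)$ for all $a_i\in\mathbb R$ and all mutually commuting projections $P_1,\dots,P_n\in\mathcal P(\mathcal M)$; 2. each self-adjoint $A\in\mathcal M$ is a norm limit of operators $A_i$ which commute with $A$ and are finite real-linear combinations of pairwise orthogonal projections in $\mathcal M$, and $T(A)=\lim_i T(A_i)$ in norm for every sequence of such operators $A_i$ converging to $A$ in norm; 3. $T(A_1+iA_2)=T(A_1)+iT(A_2)$ for all self-adjoint $A_1,A_2\in\mathcal M$ for which $A_1+iA_2$ is normal. Hence $\mathcal M$ and $\mathcal N$ are isomorphic as partial von Neumann algebras if and only if their projection lattices are isomorphic as complete orthomodular lattices. -/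

import Mathlib

open Filter Topology
open scoped InnerProductSpace

/-! ### Complete orthomodular lattices -/

/-- A complete orthomodular lattice: a complete lattice with an orthocomplementation
`a ↦ aᶜ` satisfying the orthomodular law. -/
class CompleteOrthomodularLattice (L : Type*) extends CompleteLattice L, Compl L where
  compl_compl' : ∀ a : L, aᶜᶜ = a
  compl_antitone' : ∀ a b : L, a ≤ b → bᶜ ≤ aᶜ
  inf_compl' : ∀ a : L, a ⊓ aᶜ = ⊥
  sup_compl' : ∀ a : L, a ⊔ aᶜ = ⊤
  orthomodular' : ∀ a b : L, a ≤ b → a ⊔ (aᶜ ⊓ b) = b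

/-- An isomorphism of complete orthomodular lattices: a bijection that preserves all joins,
all meets and the orthocomplement. -/
structure COMLIso (L L' : Type*) [CompleteOrthomodularLattice L]
    [CompleteOrthomodularLattice L'] extends L ≃ L' where
  map_sSup' : ∀ S : Set L, toFun (sSup S) = sSup (toFun '' S)
  map_sInf' : ∀ S : Set L, toFun (sInf S) = sInf (toFun '' S)
  map_compl' : ∀ a : L, toFun aᶜ = (toFun a)ᶜ

/-! ### The projection lattice of a von Neumann algebra -/

/-- The projections (self-adjoint idempotents) of a von Neumann algebra `M`. -/
@[ext]
structure ProjLattice {H : Type*} [NormedAddCommGroup H] [InnerProductSpace ℂ H] [CompleteSpace H]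
    (M : VonNeumannAlgebra H) where
  /-- the underlying operator -/
  val : H →L[ℂ] H
  mem : val ∈ M
  isProj : IsStarProjection val

namespace ProjLattice

variable {H : Type*} [NormedAddCommGroup H] [InnerProductSpace ℂ H] [CompleteSpace H]
  {M : VonNeumannAlgebra H}

/-- Projections are ordered as operators. -/
noncomputable instance : PartialOrder (ProjLattice M) :=
  PartialOrder.lift ProjLattice.val (fun _ _ h => ProjLattice.ext h)

theorem le_iff_mul {P Q : ProjLattice M} : P ≤ Q ↔ Q.val * P.val = P.val :=
  (P.isProj.le_tfae Q.isProj).out 0 1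

theorem le_iff_range {P Q : ProjLattice M} :
    P ≤ Q ↔ P.val.range ≤ Q.val.range := by
  rw [le_iff_mul]
  constructor
  · rintro h _ ⟨x, rfl⟩
    exact ⟨P.val x, congrArg (fun A : H →L[ℂ] H => A x) h⟩
  · intro h
    ext x
    obtain ⟨y, hy⟩ := h ⟨x, rfl⟩
    have hQ : Q.val * Q.val = Q.val := Q.isProj.isIdempotentElem
    change Q.val y = P.val x at hy
    change Q.val (P.val x) = P.val x
    rw [← hy]
    exact congrArg (fun A : H →L[ℂ] H => A y) hQ

theorem isClosed_range (P : ProjLattice M) : IsClosed (P.val.range : Set H) := by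
  have : (P.val.range : Set H) = {x | P.val x = x} := by
    ext x
    constructor
    · rintro ⟨y, rfl⟩
      exact congrArg (fun A : H →L[ℂ] H => A y) P.isProj.isIdempotentElem
    · intro h
      exact ⟨x, h⟩
  rw [this]
  exact isClosed_eq P.val.continuous continuous_id

theorem isClosed_iInf_range (S : Set (ProjLattice M)) :
    IsClosed ((⨅ P ∈ S, P.val.range : Submodule ℂ H) : Set H) := by
  simp only [Submodule.coe_iInf]
  exact isClosed_iInter fun P => isClosed_iInter fun _ => P.isClosed_range

instance (S : Set (ProjLattice M)) :
    (⨅ P ∈ S, P.val.range : Submodule ℂ H).HasOrthogonalProjection :=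
  haveI : CompleteSpace (⨅ P ∈ S, P.val.range : Submodule ℂ H) :=
    (isClosed_iInf_range S).completeSpace_coe
  inferInstance

/-- The meet of a set of projections is the projection onto the intersection of the ranges. -/
noncomputable instance : InfSet (ProjLattice M) where
  sInf S :=
    { val := (⨅ P ∈ S, P.val.range : Submodule ℂ H).starProjection
      mem := by
        rw [VonNeumannAlgebra.IsStarProjection.mem_iff isStarProjection_starProjection]
        intro y hy
        rw [Module.End.mem_invtSubmodule_iff_forall_mem_of_mem]
        intro x hx
        rw [Submodule.range_starProjection] at hx ⊢
        simp only [Submodule.mem_iInf] at hx ⊢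
        intro P hP
        have := (VonNeumannAlgebra.IsStarProjection.mem_iff P.isProj M).1 P.mem y hy
        exact this (hx P hP)
      isProj := isStarProjection_starProjection }

theorem range_sInf (S : Set (ProjLattice M)) :
    (sInf S).val.range = ⨅ P ∈ S, P.val.range :=
  Submodule.range_starProjection _

theorem isGLB_sInf' (S : Set (ProjLattice M)) : IsGLB S (sInf S) := by
  constructor
  · intro P hP
    rw [le_iff_range, range_sInf]
    exact iInf₂_le P hP
  · intro Q hQ
    rw [le_iff_range, range_sInf]
    exact le_iInf₂ fun P hP => le_iff_range.1 (hQ hP)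

noncomputable instance : CompleteLattice (ProjLattice M) :=
  completeLatticeOfInf _ isGLB_sInf'

/-- The orthocomplement of `P` is `1 - P`. -/
noncomputable instance : Compl (ProjLattice M) where
  compl P := ⟨1 - P.val, sub_mem (one_mem M) P.mem, P.isProj.one_sub⟩

theorem val_compl (P : ProjLattice M) : (Pᶜ).val = 1 - P.val := rfl

theorem compl_compl (P : ProjLattice M) : Pᶜᶜ = P := by
  ext1; simp [val_compl]

theorem compl_antitone (P Q : ProjLattice M) (h : P ≤ Q) : Qᶜ ≤ Pᶜ := by
  have h' : P.val ≤ Q.val := h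
  have : (1 : H →L[ℂ] H) - Q.val ≤ 1 - P.val := sub_le_sub_left h' 1
  exact this

theorem inf_compl (P : ProjLattice M) : P ⊓ Pᶜ = ⊥ := by
  apply bot_unique
  have h1 := le_iff_mul.1 (inf_le_left : P ⊓ Pᶜ ≤ P)
  have h2 := le_iff_mul.1 (inf_le_right : P ⊓ Pᶜ ≤ Pᶜ)
  rw [val_compl, sub_mul, one_mul, h1, sub_self] at h2
  rw [le_iff_mul, ← h2, mul_zero]

theorem sup_compl (P : ProjLattice M) : P ⊔ Pᶜ = ⊤ := by
  have h : (P ⊔ Pᶜ)ᶜ ≤ ⊥ := by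
    rw [← inf_compl P]
    refine le_inf ?_ (compl_antitone _ _ le_sup_left)
    have := compl_antitone _ _ (le_sup_right : Pᶜ ≤ P ⊔ Pᶜ)
    rwa [compl_compl] at this
  apply top_unique
  have h2 := compl_antitone _ _ (h.trans (bot_le : ⊥ ≤ (⊤ : ProjLattice M)ᶜ))
  rwa [compl_compl, compl_compl] at h2

theorem orthomodular (P Q : ProjLattice M) (h : P ≤ Q) : P ⊔ (Pᶜ ⊓ Q) = Q := by
  apply le_antisymm (sup_le h inf_le_right)
  have hQP := le_iff_mul.1 h
  let D : ProjLattice M :=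
    ⟨Q.val - P.val, sub_mem Q.mem P.mem, P.isProj.sub_of_mul_eq_right Q.isProj hQP⟩
  have hP : P.val * P.val = P.val := P.isProj.isIdempotentElem
  have hQ : Q.val * Q.val = Q.val := Q.isProj.isIdempotentElem
  have hPQ : P.val * Q.val = P.val := ((P.isProj.le_tfae Q.isProj).out 0 2).1 h
  have hD : D ≤ Pᶜ ⊓ Q := by
    refine le_inf (le_iff_mul.2 ?_) (le_iff_mul.2 ?_)
    · change (1 - P.val) * (Q.val - P.val) = Q.val - P.val
      rw [sub_mul, one_mul, mul_sub, hPQ, hP, sub_self, sub_zero]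
    · change Q.val * (Q.val - P.val) = Q.val - P.val
      rw [mul_sub, hQ, hQP]
  have h1 := le_iff_mul.1 (le_sup_left : P ≤ P ⊔ (Pᶜ ⊓ Q))
  have h2 := le_iff_mul.1 (hD.trans (le_sup_right : _ ≤ P ⊔ (Pᶜ ⊓ Q)))
  change _ * (Q.val - P.val) = Q.val - P.val at h2
  rw [mul_sub, h1, sub_left_inj] at h2
  exact le_iff_mul.2 h2

/-- The projections of a von Neumann algebra form a complete orthomodular lattice. -/
noncomputable instance : CompleteOrthomodularLattice (ProjLattice M) where
  compl_compl' := compl_compl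
  compl_antitone' := compl_antitone
  inf_compl' := inf_compl
  sup_compl' := sup_compl
  orthomodular' := orthomodular

end ProjLattice

/-! ### The ultraweak topology -/

/-- The ultraweak (σ-weak) topology on the bounded operators on `H`: the coarsest topology for
which all functionals `A ↦ ∑ₙ ⟪ξₙ, A ηₙ⟫` are continuous, where `ξ` and `η` range over the
square-summable sequences of vectors. -/
noncomputable abbrev ultraweakTopology (H : Type*) [NormedAddCommGroup H] [InnerProductSpace ℂ H]
    [CompleteSpace H] : TopologicalSpace (H →L[ℂ] H) :=
  ⨅ (ξ : lp (fun _ : ℕ => H) 2) (η : lp (fun _ : ℕ => H) 2),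
    TopologicalSpace.induced (fun A : H →L[ℂ] H => ∑' n, ⟪ξ n, A (η n)⟫_ℂ)
      (inferInstance : TopologicalSpace ℂ)

/-! ### Partial von Neumann algebras -/

/-- The underlying set of the partial von Neumann algebra associated with `M`: the normal
operators in `M`. -/
@[ext]
structure NormalPart {H : Type*} [NormedAddCommGroup H] [InnerProductSpace ℂ H] [CompleteSpace H]
    (M : VonNeumannAlgebra H) where
  /-- the underlying operator -/
  val : H →L[ℂ] H
  mem : val ∈ M
  normal : IsStarNormal val

namespace NormalPart

variable {H : Type*} [NormedAddCommGroup H] [InnerProductSpace ℂ H] [CompleteSpace H]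
  {M : VonNeumannAlgebra H}

instance : One (NormalPart M) where
  one := ⟨1, one_mem M, inferInstance⟩

noncomputable instance : Star (NormalPart M) where
  star A := ⟨star A.val, star_mem A.mem, haveI := A.normal; inferInstance⟩

/-- The partial linear structure: `a • A + b • B`, for commuting `A` and `B`. -/
def lin (a b : ℂ) (A B : NormalPart M) (h : Commute A.val B.val) : NormalPart M where
  val := a • A.val + b • B.val
  mem := by
    have hs : ∀ (c : ℂ) (C : H →L[ℂ] H), C ∈ M → c • C ∈ M := fun c C hC =>
      M.toStarSubalgebra.smul_mem hC c
    exact add_mem (hs a _ A.mem) (hs b _ B.mem)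
  normal := by
    have hA := A.normal.star_comm_self
    have hB := B.normal.star_comm_self
    have h1 : Commute (star A.val) B.val := A.normal.commute_star_left h
    have h2 : Commute (star B.val) A.val := B.normal.commute_star_left h.symm
    constructor
    rw [star_add, star_smul, star_smul]
    exact Commute.add_left
      (Commute.add_right ((hA.smul_left _).smul_right _) ((h1.smul_left _).smul_right _))
      (Commute.add_right ((h2.smul_left _).smul_right _) ((hB.smul_left _).smul_right _))

/-- The partial multiplication: `A * B`, for commuting `A` and `B`. -/
def mul (A B : NormalPart M) (h : Commute A.val B.val) : NormalPart M where
  val := A.val * B.val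
  mem := mul_mem A.mem B.mem
  normal := by
    have hA := A.normal.star_comm_self
    have hB := B.normal.star_comm_self
    have h1 : Commute (star A.val) B.val := A.normal.commute_star_left h
    have h2 : Commute (star B.val) A.val := B.normal.commute_star_left h.symm
    constructor
    rw [star_mul]
    exact Commute.mul_left (h2.mul_right hB) (hA.mul_right h1)

/-- The ultraweak topology on the normal operators in `M`. -/
noncomputable instance : TopologicalSpace (NormalPart M) :=
  TopologicalSpace.induced NormalPart.val (ultraweakTopology H)

end NormalPart

/-- A projection, as an element of the partial von Neumann algebra. -/
def ProjLattice.toNormalPart {H : Type*} [NormedAddCommGroup H] [InnerProductSpace ℂ H]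
    [CompleteSpace H] {M : VonNeumannAlgebra H} (P : ProjLattice M) : NormalPart M :=
  ⟨P.val, P.mem, P.isProj.isStarNormal⟩

section

variable {H K : Type*} [NormedAddCommGroup H] [InnerProductSpace ℂ H] [CompleteSpace H]
  [NormedAddCommGroup K] [InnerProductSpace ℂ K] [CompleteSpace K]

/-- A morphism of partial von Neumann algebras: a unital map that preserves linear combinations
and products of commuting elements and the involution, and is normal, that is, ultraweakly
continuous on ultraweakly closed commuting sets. -/
structure IsPartialVNMorphism {M : VonNeumannAlgebra H} {N : VonNeumannAlgebra K}
    (T : NormalPart M → NormalPart N) : Prop where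
  map_one : T 1 = 1
  map_lin : ∀ (A B : NormalPart M) (h : Commute A.val B.val) (a b : ℂ),
    (T (NormalPart.lin a b A B h)).val = a • (T A).val + b • (T B).val
  map_mul : ∀ (A B : NormalPart M) (h : Commute A.val B.val),
    (T (NormalPart.mul A B h)).val = (T A).val * (T B).val
  map_star : ∀ A : NormalPart M, T (star A) = star (T A)
  normal : ∀ S : Set (NormalPart M), (∀ A ∈ S, ∀ B ∈ S, Commute A.val B.val) →
    IsClosed[ultraweakTopology H] (NormalPart.val '' S) → ContinuousOn T S

/-- An isomorphism of partial von Neumann algebras: a bijection which is a morphism together with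
its inverse. -/
structure PartialVNIso (M : VonNeumannAlgebra H) (N : VonNeumannAlgebra K) extends
    NormalPart M ≃ NormalPart N where
  isMorphism : IsPartialVNMorphism toFun
  isMorphism_symm : IsPartialVNMorphism invFun

/-- The operator `A` is a finite real-linear combination of pairwise orthogonal projections
of `M`. -/
def IsFiniteProjComb {M : VonNeumannAlgebra H} (A : NormalPart M) : Prop :=
  ∃ (n : ℕ) (a : Fin n → ℝ) (P : Fin n → ProjLattice M),
    (∀ i j, i ≠ j → (P i).val * (P j).val = 0) ∧ A.val = ∑ i, (a i : ℂ) • (P i).val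

end

/-! A lattice isomorphism `τ` sees commutation, because `P` and `Q` commute exactly when `P = (P ⊓
Q) ⊔ (P ⊓ Qᶜ)`. On a Boolean algebra `C` of commuting projections, meets are products and orthogonal
joins are sums. Every element of the span of `C` is a combination of orthogonal projections with sum
`1`, and its norm is the largest coefficient of a nonzero projection. Since `τ` respects this data,
the closed span of the pairs `(P, τ P)` is the graph of an isometric star homomorphism
(`norm_fst_eq_norm_snd`, `graph_unique`).

Spectral approximation puts a self-adjoint `A` in the closed span of the projections of its
bicommutant (`exists_mem_span_norm_sub_le`). Fuglede's theorem brings in normal operators. Two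
commuting operators lie in the domain of one common graph, which gives the algebraic laws for
`extend`. Conversely, a morphism is contractive on commuting self-adjoint elements (`norm_sub_le`),
so its values on projections determine it (`eq_of_eq_on_projections`).

The analytic core is ultraweak continuity of `extend`. For square-summable `x`, the function `P ↦ ∑ₙ
‖τ P xₙ‖²` is a positive charge on `C`, continuous along chains since `τ` preserves suprema. A
Radon-Nikodym type argument finds a nonzero vector functional below any nonzero such charge
(`exists_ne_zero_norm_sq_le`), and greedy exhaustion writes the charge as a countable sum of vector
functionals (`exists_hasSum_norm_sq`). Thus diagonal ultraweak functionals pull back to ultraweak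
ones, and polarization handles the rest. -/

namespace ProjLattice

variable {H : Type*} [NormedAddCommGroup H] [InnerProductSpace ℂ H] [CompleteSpace H]
  {M : VonNeumannAlgebra H}

/-! ### Products, sums and strong limits in the projection lattice. -/

theorem mul_self (P : ProjLattice M) : P.val * P.val = P.val := P.isProj.isIdempotentElem

theorem star_val (P : ProjLattice M) : star P.val = P.val := P.isProj.isSelfAdjoint

theorem le_iff_mul' {P Q : ProjLattice M} : P ≤ Q ↔ P.val * Q.val = P.val :=
  (P.isProj.le_tfae Q.isProj).out 0 2

theorem commute_of_le {P Q : ProjLattice M} (h : P ≤ Q) : Commute P.val Q.val :=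
  (le_iff_mul'.1 h).trans (le_iff_mul.1 h).symm

theorem le_compl_iff {P Q : ProjLattice M} : P ≤ Qᶜ ↔ P.val * Q.val = 0 := by
  rw [le_iff_mul', val_compl, mul_sub, mul_one, sub_eq_self]

theorem commute_of_le_compl {P Q : ProjLattice M} (h : P ≤ Qᶜ) : Commute P.val Q.val := by
  have := (commute_of_le h).sub_right (Commute.one_right _)
  rw [val_compl, sub_sub_cancel_left] at this
  simpa using this.neg_right

theorem val_inf {P Q : ProjLattice M} (h : Commute P.val Q.val) :
    (P ⊓ Q).val = P.val * Q.val := by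
  let D : ProjLattice M := ⟨P.val * Q.val, mul_mem P.mem Q.mem, P.isProj.mul Q.isProj h⟩
  suffices P ⊓ Q = D from congrArg ProjLattice.val this
  apply le_antisymm
  · have h1 := le_iff_mul.1 (inf_le_left : P ⊓ Q ≤ P)
    have h2 := le_iff_mul.1 (inf_le_right : P ⊓ Q ≤ Q)
    rw [le_iff_mul]
    change P.val * Q.val * _ = _
    rw [mul_assoc, h2, h1]
  · refine le_inf (le_iff_mul.2 ?_) (le_iff_mul.2 ?_)
    · change P.val * (P.val * Q.val) = P.val * Q.val
      rw [← mul_assoc, mul_self]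
    · change Q.val * (P.val * Q.val) = P.val * Q.val
      rw [h.eq, ← mul_assoc, mul_self]

theorem val_sup_of_orthogonal {P Q : ProjLattice M} (h : P.val * Q.val = 0) :
    (P ⊔ Q).val = P.val + Q.val := by
  have h' : Q.val * P.val = 0 := by
    have := congrArg star h
    rwa [star_mul, star_val, star_val, star_zero] at this
  let D : ProjLattice M := ⟨P.val + Q.val, add_mem P.mem Q.mem, P.isProj.add Q.isProj h⟩
  suffices P ⊔ Q = D from congrArg ProjLattice.val this
  apply le_antisymm
  · refine sup_le (le_iff_mul.2 ?_) (le_iff_mul.2 ?_)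
    · change (P.val + Q.val) * P.val = P.val
      rw [add_mul, mul_self, h', add_zero]
    · change (P.val + Q.val) * Q.val = Q.val
      rw [add_mul, mul_self, h, zero_add]
  · have h1 := le_iff_mul.1 (le_sup_left : P ≤ P ⊔ Q)
    have h2 := le_iff_mul.1 (le_sup_right : Q ≤ P ⊔ Q)
    rw [le_iff_mul]
    change _ * (P.val + Q.val) = P.val + Q.val
    rw [mul_add, h1, h2]

theorem val_top : (⊤ : ProjLattice M).val = 1 := by
  let D : ProjLattice M := ⟨1, one_mem M, .one _⟩
  have : D ≤ ⊤ := le_top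
  simpa [D] using le_iff_mul.1 this

theorem val_bot : (⊥ : ProjLattice M).val = 0 := by
  let D : ProjLattice M := ⟨0, zero_mem M, .zero _⟩
  have : ⊥ ≤ D := bot_le
  simpa [D, eq_comm] using le_iff_mul.1 this

/-- Two projections commute if and only if they are compatible in the projection lattice. -/
theorem commute_iff_eq_sup {P Q : ProjLattice M} :
    Commute P.val Q.val ↔ P = (P ⊓ Q) ⊔ (P ⊓ Qᶜ) := by
  have hor : (P ⊓ Q).val * (P ⊓ Qᶜ).val = 0 := by
    rw [← le_compl_iff]
    have := compl_antitone _ _ (inf_le_right : P ⊓ Qᶜ ≤ Qᶜ)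
    rw [compl_compl] at this
    exact inf_le_right.trans this
  constructor
  · intro h
    ext1
    rw [val_sup_of_orthogonal hor, val_inf h,
      val_inf (show Commute P.val Qᶜ.val from (Commute.one_right _).sub_right h), val_compl,
      mul_sub, mul_one, add_sub_cancel]
  · intro h
    -- `P` is the sum of a projection below `Q` and one below `Qᶜ`, and both of these commute with
    -- `Q`.
    rw [h, val_sup_of_orthogonal hor]
    exact (commute_of_le inf_le_right).add_left (commute_of_le_compl inf_le_right)

theorem compl_sSup (S : Set (ProjLattice M)) : (sSup S)ᶜ = sInf (compl '' S) := by
  apply le_antisymm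
  · refine le_sInf ?_
    rintro _ ⟨P, hP, rfl⟩
    exact compl_antitone _ _ (le_sSup hP)
  · have : sSup S ≤ (sInf (compl '' S))ᶜ := by
      refine sSup_le fun P hP => ?_
      have := compl_antitone _ _ (sInf_le ⟨P, hP, rfl⟩ : sInf (compl '' S) ≤ Pᶜ)
      rwa [compl_compl] at this
    have := compl_antitone _ _ this
    rwa [compl_compl] at this

theorem range_compl (P : ProjLattice M) : (Pᶜ).val.range = P.val.rangeᗮ := by
  have := P.isProj.isSelfAdjoint.isSymmetric
  ext x
  rw [Submodule.mem_orthogonal]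
  constructor
  · rintro ⟨y, rfl⟩ _ ⟨z, rfl⟩
    change ⟪P.val z, (1 - P.val) y⟫_ℂ = 0
    have h1 : P.val ((1 - P.val) y) = 0 := by
      rw [← mul_apply_eq_comp, mul_sub, mul_one, mul_self, sub_self]; rfl
    have h2 : ⟪P.val z, (1 - P.val) y⟫_ℂ = ⟪z, P.val ((1 - P.val) y)⟫_ℂ := this z _
    rw [h2, h1, inner_zero_right]
  · intro h
    refine ⟨x, ?_⟩
    change x - P.val x = x
    have h1 : ⟪P.val (P.val x), x⟫_ℂ = 0 := h _ ⟨_, rfl⟩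
    have h2 : ⟪P.val (P.val x), x⟫_ℂ = ⟪P.val x, P.val x⟫_ℂ := this (P.val x) x
    rw [h2, inner_self_eq_zero] at h1
    rw [h1, sub_zero]

theorem range_sSup (S : Set (ProjLattice M)) :
    (sSup S).val.range = (⨆ P : S, P.val.val.range : Submodule ℂ H).topologicalClosure := by
  rw [← compl_compl (sSup S), range_compl, compl_sSup, range_sInf, iInf_image]
  simp only [range_compl]
  rw [← Submodule.orthogonal_orthogonal_eq_closure, ← Submodule.iInf_orthogonal, iInf_subtype]

instance hasOrthogonalProjection_range (P : ProjLattice M) :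
    P.val.range.HasOrthogonalProjection :=
  haveI : CompleteSpace P.val.range := P.isClosed_range.completeSpace_coe
  inferInstance

theorem starProjection_range (P : ProjLattice M) :
    P.val.range.starProjection = P.val := by
  obtain ⟨_, h⟩ := isStarProjection_iff_eq_starProjection_range.1 P.isProj
  exact h.symm

theorem range_iSup {ι : Type*} (f : ι → ProjLattice M) :
    (⨆ i, f i).val.range = (⨆ i, (f i).val.range : Submodule ℂ H).topologicalClosure := by
  rw [iSup, range_sSup]
  congr 1
  exact iSup_range' (fun P : ProjLattice M => (P.val.range : Submodule ℂ H)) f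

/-- A directed family of projections converges strongly to its supremum. -/
theorem tendsto_iSup_apply {ι : Type*} [Preorder ι] {f : ι → ProjLattice M} (hf : Monotone f)
    (x : H) : Tendsto (fun i => (f i).val x) atTop (𝓝 ((⨆ i, f i).val x)) := by
  have hmono : Monotone fun i => (f i).val.range := fun i j h => le_iff_range.1 (hf h)
  have := Submodule.starProjection_tendsto_closure_iSup (fun i => (f i).val.range) hmono x
  simp only [starProjection_range] at this
  convert! this
  -- `starProjection` carries an instance depending on the subspace, so equality of subspaces is
  -- transported by substitution rather than by rewriting.
  have : ∀ (U V : Submodule ℂ H) [U.HasOrthogonalProjection] [V.HasOrthogonalProjection], U = V →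
      U.starProjection = V.starProjection := by
    rintro U V _ _ rfl; rfl
  rw [← this (⨆ i, f i).val.range _ (range_iSup f), starProjection_range]

theorem tendsto_sSup_apply (S : Set (ProjLattice M)) (x : H) :
    Tendsto (fun P : S => P.val.val x) atTop (𝓝 ((sSup S).val x)) := by
  rw [sSup_eq_iSup']
  exact tendsto_iSup_apply (f := fun P : S => P.val) (Subtype.mono_coe S) x

end ProjLattice

/-! ### Orthogonal partitions, norms of combinations and spectral approximation. -/

/-- In the linear span of a Boolean algebra of commuting idempotents every element is a linear
combination of orthogonal idempotents with sum `1`. -/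
theorem exists_orthogonal_partition_of_mem_span {𝕜 R : Type*} [CommRing 𝕜] [Ring R] [Algebra 𝕜 R]
    {G : Set R} (one_mem : 1 ∈ G) (mul_mem : ∀ x ∈ G, ∀ y ∈ G, x * y ∈ G)
    (compl_mem : ∀ x ∈ G, 1 - x ∈ G) (idem : ∀ x ∈ G, x * x = x)
    (comm : ∀ x ∈ G, ∀ y ∈ G, x * y = y * x) {x : R} (hx : x ∈ Submodule.span 𝕜 G) :
    ∃ (ι : Type) (_ : Fintype ι) (a : ι → 𝕜) (q : ι → R), (∀ i, q i ∈ G) ∧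
      (∀ i j, i ≠ j → q i * q j = 0) ∧ ∑ i, q i = 1 ∧ x = ∑ i, a i • q i := by
  induction hx using Submodule.span_induction with
  | mem x hx =>
    refine ⟨Bool, inferInstance, fun b => if b then 1 else 0, fun b => if b then x else 1 - x,
      ?_, ?_, ?_, ?_⟩
    · rintro (_ | _)
      · simpa using compl_mem x hx
      · simpa using hx
    · rintro (_ | _) (_ | _) h
      · exact absurd rfl h
      · simp [sub_mul, idem x hx]
      · simp [mul_sub, idem x hx]
      · exact absurd rfl h
    · simp
    · simp
  | zero => exact ⟨Unit, inferInstance, fun _ => 0, fun _ => 1, fun _ => one_mem,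
      fun i j h => absurd rfl h, by simp, by simp⟩
  | add x y _ _ hx hy =>
    obtain ⟨ι, _, a, q, hq, ho, hs, rfl⟩ := hx
    obtain ⟨κ, _, b, r, hr, ho', hs', rfl⟩ := hy
    -- The common refinement of the two partitions. Summing out one index returns the original
    -- combination, since the other partition has sum `1`.
    refine ⟨ι × κ, inferInstance, fun p => a p.1 + b p.2, fun p => q p.1 * r p.2,
      fun p => mul_mem _ (hq _) _ (hr _), ?_, ?_, ?_⟩
    · rintro ⟨i, k⟩ ⟨j, l⟩ h
      have : q i * r k * (q j * r l) = (q i * q j) * (r k * r l) := by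
        rw [mul_assoc, ← mul_assoc (r k), comm (r k) (hr k) (q j) (hq j)]
        simp only [mul_assoc]
      simp only [this]
      by_cases hij : i = j
      · have : k ≠ l := fun hkl => h (by rw [hij, hkl])
        rw [ho' k l this, mul_zero]
      · rw [ho i j hij, zero_mul]
    · rw [Fintype.sum_prod_type]
      simp only [← Finset.mul_sum, hs', mul_one, hs]
    · rw [Fintype.sum_prod_type]
      simp only [add_smul, Finset.sum_add_distrib]
      congr 1
      · simp only [← Finset.smul_sum, ← Finset.mul_sum, hs', mul_one]
      · rw [Finset.sum_comm]
        simp only [← Finset.smul_sum, ← Finset.sum_mul, hs, one_mul]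
  | smul c x _ hx =>
    obtain ⟨ι, _, a, q, hq, ho, hs, rfl⟩ := hx
    exact ⟨ι, inferInstance, fun i => c * a i, q, hq, ho, hs, by
      simp only [Finset.smul_sum, mul_smul]⟩

section

variable {H : Type*} [NormedAddCommGroup H] [InnerProductSpace ℂ H] [CompleteSpace H]

/-- The orthogonal decomposition of the identity given by orthogonal projections of sum `1`. -/
theorem norm_sq_sum_smul_projection {ι : Type*} [Fintype ι] (a : ι → ℂ) (q : ι → H →L[ℂ] H)
    (hq : ∀ i, IsStarProjection (q i)) (ho : ∀ i j, i ≠ j → q i * q j = 0) (x : H) :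
    ‖(∑ i, a i • q i) x‖ ^ 2 = ∑ i, ‖a i‖ ^ 2 * ‖q i x‖ ^ 2 := by
  have h1 : (∑ i, a i • q i) x = ∑ i, a i • q i x := by
    simp
  have h2 (i j : ι) (hij : i ≠ j) : ⟪q i x, q j x⟫_ℂ = 0 := by
    have : ⟪q i x, q j x⟫_ℂ = ⟪x, q i (q j x)⟫_ℂ :=
      (hq i).isSelfAdjoint.isSymmetric x _
    rw [this, ← mul_apply_eq_comp, ho i j hij]; simp
  have h3 : ⟪(∑ i, a i • q i) x, (∑ i, a i • q i) x⟫_ℂ = ∑ i, (‖a i‖ ^ 2 * ‖q i x‖ ^ 2 : ℂ) := by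
    rw [h1, sum_inner]
    refine Finset.sum_congr rfl fun i _ => ?_
    rw [inner_sum, Finset.sum_eq_single i]
    · rw [inner_smul_left, inner_smul_right, inner_self_eq_norm_sq_to_K, ← mul_assoc,
        Complex.conj_mul']
      simp
    · intro j _ hj
      rw [inner_smul_left, inner_smul_right, h2 i j hj.symm, mul_zero, mul_zero]
    · simp
  rw [inner_self_eq_norm_sq_to_K] at h3
  generalize (∑ i, a i • q i) x = y at h3 ⊢
  have h4 : (‖y‖ : ℂ) ^ 2 = ∑ i, (‖a i‖ ^ 2 * ‖q i x‖ ^ 2 : ℂ) := h3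
  exact_mod_cast h4

/-- The norm depends only on the coefficients and on which projections vanish, and lattice
isomorphisms preserve the latter. Comparing with a bound `c` avoids a maximum over an index set that
is empty when `H = 0`. -/
theorem norm_sum_smul_projection_le_iff {ι : Type*} [Fintype ι] (a : ι → ℂ)
    (q : ι → H →L[ℂ] H) (hq : ∀ i, IsStarProjection (q i))
    (ho : ∀ i j, i ≠ j → q i * q j = 0) (hs : ∑ i, q i = 1) {c : ℝ} (hc : 0 ≤ c) :
    ‖∑ i, a i • q i‖ ≤ c ↔ ∀ i, q i ≠ 0 → ‖a i‖ ≤ c := by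
  constructor
  · intro h i hi
    obtain ⟨x, hx⟩ : ∃ x, q i x ≠ 0 := by
      by_contra! h0
      exact hi (ContinuousLinearMap.ext h0)
    have h1 : (∑ j, a j • q j) (q i x) = a i • q i x := by
      rw [sum_apply, Finset.sum_eq_single i]
      · change a i • (q i * q i) x = _
        rw [(hq i).isIdempotentElem.eq]
      · intro j _ hj
        change a j • (q j * q i) x = _
        rw [ho j i hj]; simp
      · simp
    have h2 := (∑ j, a j • q j).le_of_opNorm_le h (q i x)
    rw [h1, norm_smul] at h2
    exact le_of_mul_le_mul_right h2 (norm_pos_iff.2 hx)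
  · intro h
    refine ContinuousLinearMap.opNorm_le_bound _ hc fun x => ?_
    have h1 := norm_sq_sum_smul_projection (fun _ => 1) q hq ho x
    simp only [one_smul, hs, norm_one, one_pow, one_mul, one_apply_eq_self] at h1
    refine le_of_sq_le_sq ?_ (by positivity)
    rw [norm_sq_sum_smul_projection a q hq ho, mul_pow, h1, Finset.mul_sum]
    refine Finset.sum_le_sum fun i _ => ?_
    by_cases hi : q i = 0
    · simp [hi]
    · gcongr
      exact h i hi

theorem IsSelfAdjoint.norm_le_of_le_of_neg_le {Y : H →L[ℂ] H} (hY : IsSelfAdjoint Y) {r : ℝ}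
    (hr : 0 ≤ r) (h1 : Y ≤ algebraMap ℝ _ r) (h2 : -algebraMap ℝ _ r ≤ Y) : ‖Y‖ ≤ r := by
  cases subsingleton_or_nontrivial (H →L[ℂ] H)
  · rwa [Subsingleton.elim Y 0, norm_zero]
  rw [← map_neg] at h2
  rcases CStarAlgebra.norm_or_neg_norm_mem_spectrum (ha := hY) with h | h
  · exact (le_algebraMap_iff_spectrum_le hY).1 h1 _ h
  · exact neg_le_neg_iff.1 ((algebraMap_le_iff_le_spectrum hY).1 h2 _ h)

/-- A self-adjoint operator is within half its norm of a multiple of a symmetry in its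
bicommutant. -/
theorem exists_isStarProjection_norm_sub_le (X : H →L[ℂ] H) (hX : IsSelfAdjoint X) :
    ∃ P : H →L[ℂ] H, IsStarProjection P ∧ P ∈ Set.centralizer (Set.centralizer {X}) ∧
      ‖X - ((‖X‖ / 2 : ℝ) : ℂ) • (2 • P - 1)‖ ≤ ‖X‖ / 2 := by
  have hcl : IsClosed ((X⁻).ker : Set H) := (X⁻).isClosed_ker
  have : CompleteSpace (X⁻).ker := hcl.completeSpace_coe
  -- The kernel of `X⁻` contains the range of `X⁺`, so `2 • P - 1` acts as a sign of `X`.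
  set P := (X⁻).ker.starProjection with hP
  have hPp : IsStarProjection P := isStarProjection_starProjection
  have hPn : X⁻ * P = 0 := by
    ext x
    exact LinearMap.mem_ker.1 (Submodule.starProjection_apply_mem (X⁻).ker x)
  have hnP : P * X⁻ = 0 := by
    have := congrArg star hPn
    rwa [star_mul, hPp.isSelfAdjoint.star_eq, (CFC.negPart_nonneg X).isSelfAdjoint.star_eq,
      star_zero] at this
  have hPpos : P * X⁺ = X⁺ := by
    ext x
    refine Submodule.starProjection_eq_self_iff.2 ?_
    exact congrArg (fun A : H →L[ℂ] H => A x) (CFC.negPart_mul_posPart X)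
  have hposP : X⁺ * P = X⁺ := by
    have := congrArg star hPpos
    rwa [star_mul, hPp.isSelfAdjoint.star_eq, (CFC.posPart_nonneg X).isSelfAdjoint.star_eq] at this
  have hdec := CFC.posPart_sub_negPart X hX
  have hPXP : P * X * P = X⁺ := by
    nth_rw 1 [← hdec]
    rw [mul_sub, hnP, sub_zero, hPpos, hposP]
  have hQXQ : (1 - P) * X * (1 - P) = - X⁻ := by
    nth_rw 1 [← hdec]
    simp only [sub_mul, mul_sub, one_mul, mul_one, hnP, hPn, hPpos, hposP, zero_mul]
    abel
  refine ⟨P, hPp, ?_, ?_⟩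
  · intro y hy
    have hyX : Commute X y := hy X rfl
    have hyX' : Commute X (star y) := by
      have := hyX.star_star
      rw [hX.star_eq] at this
      exact this
    -- An operator commuting with `X` leaves the kernel of `X⁻` invariant. Applied to `y` and to
    -- `star y`, this makes `P` commute with `y`.
    have key : ∀ z : H →L[ℂ] H, Commute X z → P * z * P = z * P := by
      intro z hz
      have hz' : Commute X⁻ z := by
        rw [CFC.negPart_def]
        exact hz.cfcₙ_real _
      ext x
      refine Submodule.starProjection_eq_self_iff.2 ?_
      change (X⁻ * z * P) x = 0
      rw [hz'.eq, mul_assoc, hPn, mul_zero]; rfl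
    have h1 := key y hyX
    have h2 := congrArg star (key _ hyX')
    simp only [star_mul, star_star, hPp.isSelfAdjoint.star_eq] at h2
    rw [← h1, mul_assoc, h2]
  · set c := ‖X‖ with hc
    have hXle : X ≤ algebraMap ℝ _ c := hX.le_algebraMap_norm_self
    have hXge : -algebraMap ℝ _ c ≤ X := hX.neg_algebraMap_norm_le_self
    have e1 : X⁺ ≤ (c : ℂ) • P := by
      have := hPp.isSelfAdjoint.conjugate_le_conjugate hXle
      rw [hPXP, Algebra.algebraMap_eq_smul_one, mul_smul_comm, mul_one, smul_mul_assoc,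
        hPp.isIdempotentElem.eq] at this
      simpa using this
    have e2 : X⁻ ≤ (c : ℂ) • (1 - P) := by
      have := hPp.one_sub.isSelfAdjoint.conjugate_le_conjugate hXge
      rw [hQXQ, Algebra.algebraMap_eq_smul_one, mul_neg, neg_mul, mul_smul_comm, mul_one,
        smul_mul_assoc, hPp.one_sub.isIdempotentElem.eq, neg_le_neg_iff] at this
      simpa using this
    have hsa : IsSelfAdjoint (X - ((c / 2 : ℝ) : ℂ) • (2 • P - 1)) := by
      refine hX.sub (IsSelfAdjoint.smul (Complex.conj_ofReal _) ?_)
      rw [two_smul]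
      exact (hPp.isSelfAdjoint.add hPp.isSelfAdjoint).sub (.one _)
    have hpos : (0 : H →L[ℂ] H) ≤ X⁺ := CFC.posPart_nonneg X
    have hneg : (0 : H →L[ℂ] H) ≤ X⁻ := CFC.negPart_nonneg X
    have hr : algebraMap ℝ (H →L[ℂ] H) (c / 2) = ((c / 2 : ℝ) : ℂ) • (1 : H →L[ℂ] H) := by
      rw [Algebra.algebraMap_eq_smul_one, Complex.coe_smul]
    have hcc : (c : ℂ) = ((c / 2 : ℝ) : ℂ) + ((c / 2 : ℝ) : ℂ) := by push_cast; ring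
    have hc0 : 0 ≤ c / 2 := by positivity
    rw [hcc] at e1 e2
    -- With `c = ‖X‖`, the gap to the upper bound `c / 2` is `(cP - X⁺) + X⁻`, and the gap to the
    -- lower bound is `(c(1 - P) - X⁻) + X⁺`.
    refine hsa.norm_le_of_le_of_neg_le hc0 ?_ ?_
    · rw [hr, ← sub_nonneg]
      have := add_nonneg (sub_nonneg.2 e1) hneg
      rw [← hdec]
      exact this.trans_eq (by module)
    · rw [hr, ← sub_nonneg]
      have := add_nonneg (sub_nonneg.2 e2) hpos
      rw [← hdec]
      exact this.trans_eq (by module)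

/-- A self-adjoint operator is a norm limit of real-linear combinations of projections in its
bicommutant. -/
theorem exists_mem_span_norm_sub_le (A : H →L[ℂ] H) (hA : IsSelfAdjoint A) (n : ℕ) :
    ∃ X ∈ Submodule.span ℝ {P : H →L[ℂ] H | IsStarProjection P ∧
        P ∈ Set.centralizer (Set.centralizer {A})}, ‖A - X‖ ≤ ‖A‖ / 2 ^ n := by
  have hle : Submodule.span ℝ {P : H →L[ℂ] H | IsStarProjection P ∧
      P ∈ Set.centralizer (Set.centralizer {A})} ≤
        Subalgebra.toSubmodule (Subalgebra.centralizer ℝ (Set.centralizer {A})) ⊓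
          selfAdjoint.submodule ℝ (H →L[ℂ] H) :=
    Submodule.span_le.2 fun P hP => ⟨hP.2, hP.1.isSelfAdjoint⟩
  induction n with
  | zero => exact ⟨0, zero_mem _, by simp⟩
  | succ n ih =>
    obtain ⟨X, hX, hXn⟩ := ih
    obtain ⟨P, hP, hPc, hPn⟩ := exists_isStarProjection_norm_sub_le (A - X) (hA.sub (hle hX).2)
    have hAc : A - X ∈ Set.centralizer (Set.centralizer {A}) :=
      Subalgebra.sub_mem (Subalgebra.centralizer ℝ (Set.centralizer {A}))
        (Set.subset_centralizer_centralizer rfl) (hle hX).1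
    -- The remainder `A - X` lies in the bicommutant of `A`, so its own bicommutant adds nothing
    -- new. Each step halves the error.
    have hPA : P ∈ Set.centralizer (Set.centralizer {A}) := by
      intro y hy
      refine hPc y ?_
      rintro _ rfl
      exact (hAc y hy).symm
    have hone : (1 : H →L[ℂ] H) ∈ Submodule.span ℝ {P : H →L[ℂ] H | IsStarProjection P ∧
        P ∈ Set.centralizer (Set.centralizer {A})} :=
      Submodule.subset_span ⟨.one _, Set.one_mem_centralizer⟩
    refine ⟨X + (‖A - X‖ / 2) • (2 • P - 1), add_mem hX (Submodule.smul_mem _ _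
      (sub_mem (Submodule.smul_of_tower_mem _ _ (Submodule.subset_span ⟨hP, hPA⟩)) hone)), ?_⟩
    rw [Complex.coe_smul] at hPn
    rw [← sub_sub, pow_succ, ← div_div]
    linarith

end

/-! ### Isomorphisms of complete orthomodular lattices. -/

namespace COMLIso

variable {L L' : Type*} [CompleteOrthomodularLattice L] [CompleteOrthomodularLattice L']
  (τ : COMLIso L L')

theorem toEquiv_injective : Function.Injective (toEquiv : COMLIso L L' → L ≃ L') := by
  rintro ⟨e, _⟩ ⟨f, _⟩ rfl; rfl

theorem map_sSup (S : Set L) : τ.toEquiv (sSup S) = sSup (τ.toEquiv '' S) := τ.map_sSup' S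

theorem map_compl (a : L) : τ.toEquiv aᶜ = (τ.toEquiv a)ᶜ := τ.map_compl' a

theorem map_inf (a b : L) : τ.toEquiv (a ⊓ b) = τ.toEquiv a ⊓ τ.toEquiv b := by
  have : τ.toEquiv (sInf {a, b}) = sInf (τ.toEquiv '' {a, b}) := τ.map_sInf' _
  rwa [Set.image_pair, sInf_pair, sInf_pair] at this

theorem map_sup (a b : L) : τ.toEquiv (a ⊔ b) = τ.toEquiv a ⊔ τ.toEquiv b := by
  have := τ.map_sSup {a, b}
  rwa [Set.image_pair, sSup_pair, sSup_pair] at this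

theorem map_top : τ.toEquiv ⊤ = ⊤ := by
  have : τ.toEquiv (sInf ∅) = sInf (τ.toEquiv '' ∅) := τ.map_sInf' _
  rwa [Set.image_empty, sInf_empty, sInf_empty] at this

theorem map_bot : τ.toEquiv ⊥ = ⊥ := by
  have := τ.map_sSup ∅
  rwa [Set.image_empty, sSup_empty, sSup_empty] at this

/-- A bijection which preserves and reflects the order and preserves orthocomplements is an
isomorphism of complete orthomodular lattices. -/
def ofOrderIso (e : L ≃o L') (h : ∀ a, e aᶜ = (e a)ᶜ) : COMLIso L L' where
  toEquiv := e.toEquiv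
  map_sSup' S := by
    change e (sSup S) = sSup (e '' S)
    rw [e.map_sSup, sSup_image]
  map_sInf' S := by
    change e (sInf S) = sInf (e '' S)
    rw [e.map_sInf, sInf_image]
  map_compl' := h

/-- An isomorphism of complete orthomodular lattices as an order isomorphism. -/
def toOrderIso : L ≃o L' where
  toEquiv := τ.toEquiv
  map_rel_iff' {a b} := by
    rw [← inf_eq_left, ← τ.map_inf, τ.toEquiv.injective.eq_iff, inf_eq_left]

/-- The inverse of an isomorphism of complete orthomodular lattices. -/
def symm : COMLIso L' L :=
  ofOrderIso τ.toOrderIso.symm fun a => by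
    rw [OrderIso.symm_apply_eq]
    change aᶜ = τ.toEquiv _
    rw [map_compl]
    congr 1
    exact (τ.toEquiv.apply_symm_apply a).symm

theorem symm_toEquiv : τ.symm.toEquiv = τ.toEquiv.symm := rfl

end COMLIso

/-! ### Boolean families of projections and the graph of the extension. -/

section

variable {H K : Type*} [NormedAddCommGroup H] [InnerProductSpace ℂ H] [CompleteSpace H]
  [NormedAddCommGroup K] [InnerProductSpace ℂ K] [CompleteSpace K]
  {M : VonNeumannAlgebra H} {N : VonNeumannAlgebra K}

namespace COMLIso

variable (τ : COMLIso (ProjLattice M) (ProjLattice N))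

theorem commute {P Q : ProjLattice M} (h : Commute P.val Q.val) :
    Commute (τ.toEquiv P).val (τ.toEquiv Q).val := by
  rw [ProjLattice.commute_iff_eq_sup] at h ⊢
  conv_lhs => rw [h]
  rw [map_sup, map_inf, map_inf, map_compl]

theorem val_map_inf {P Q : ProjLattice M} (h : Commute P.val Q.val) :
    (τ.toEquiv (P ⊓ Q)).val = (τ.toEquiv P).val * (τ.toEquiv Q).val := by
  rw [map_inf, ProjLattice.val_inf (τ.commute h)]

theorem val_map_eq_zero_iff (P : ProjLattice M) : (τ.toEquiv P).val = 0 ↔ P.val = 0 := by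
  constructor
  · intro h
    have : τ.toEquiv P = τ.toEquiv ⊥ := by
      ext1; rw [h, map_bot, ProjLattice.val_bot]
    rw [τ.toEquiv.injective this, ProjLattice.val_bot]
  · intro h
    have : P = ⊥ := by ext1; rw [h, ProjLattice.val_bot]
    rw [this, map_bot, ProjLattice.val_bot]

end COMLIso

/-- A Boolean algebra of commuting projections. -/
structure IsBooleanFamily (C : Set (ProjLattice M)) : Prop where
  commute : ∀ P ∈ C, ∀ Q ∈ C, Commute P.val Q.val
  top_mem : ⊤ ∈ C
  inf_mem : ∀ P ∈ C, ∀ Q ∈ C, P ⊓ Q ∈ C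
  compl_mem : ∀ P ∈ C, Pᶜ ∈ C

theorem IsBooleanFamily.map {C : Set (ProjLattice M)} (hC : IsBooleanFamily C)
    (τ : COMLIso (ProjLattice M) (ProjLattice N)) : IsBooleanFamily (τ.toEquiv '' C) where
  commute := by
    rintro _ ⟨P, hP, rfl⟩ _ ⟨Q, hQ, rfl⟩
    exact τ.commute (hC.commute P hP Q hQ)
  top_mem := ⟨⊤, hC.top_mem, τ.map_top⟩
  inf_mem := by
    rintro _ ⟨P, hP, rfl⟩ _ ⟨Q, hQ, rfl⟩
    exact ⟨P ⊓ Q, hC.inf_mem P hP Q hQ, τ.map_inf P Q⟩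
  compl_mem := by
    rintro _ ⟨P, hP, rfl⟩
    exact ⟨Pᶜ, hC.compl_mem P hP, τ.map_compl P⟩

/-- The projections of `M` in the bicommutant of a set of operators. -/
def bicommutantProj (M : VonNeumannAlgebra H) (S : Set (H →L[ℂ] H)) : Set (ProjLattice M) :=
  {P | P.val ∈ Set.centralizer (Set.centralizer S)}

theorem mem_bicommutantProj {S : Set (H →L[ℂ] H)} {P : ProjLattice M} (h : P.val ∈ S) :
    P ∈ bicommutantProj M S := Set.subset_centralizer_centralizer h

theorem isBooleanFamily_bicommutantProj {S : Set (H →L[ℂ] H)}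
    (hS : ∀ A ∈ S, ∀ B ∈ S, Commute A B) : IsBooleanFamily (bicommutantProj M S) where
  commute P hP Q hQ := Set.centralizer_centralizer_comm_of_comm hS _ hP _ hQ
  top_mem := by
    change (⊤ : ProjLattice M).val ∈ Set.centralizer (Set.centralizer S)
    rw [ProjLattice.val_top]
    exact Set.one_mem_centralizer
  inf_mem P hP Q hQ := by
    change (P ⊓ Q).val ∈ Set.centralizer (Set.centralizer S)
    rw [ProjLattice.val_inf (Set.centralizer_centralizer_comm_of_comm hS _ hP _ hQ)]
    exact Set.mul_mem_centralizer hP hQ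
  compl_mem P hP :=
    Subalgebra.sub_mem (Subalgebra.centralizer ℂ (Set.centralizer S)) (one_mem _) hP

/-- The supremum of a chain is its strong limit, and commutation with a fixed bounded operator
survives strong limits. -/
theorem sSup_mem_bicommutantProj {S : Set (H →L[ℂ] H)} {D : Set (ProjLattice M)}
    (hD : D ⊆ bicommutantProj M S) (hc : IsChain (· ≤ ·) D) (hne : D.Nonempty) :
    sSup D ∈ bicommutantProj M S := by
  intro y hy
  have := hne.to_subtype
  have : IsDirectedOrder D := ⟨fun a b => (hc.total a.2 b.2).elim
    (fun h => ⟨b, h, le_rfl⟩) fun h => ⟨a, le_rfl, h⟩⟩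
  ext x
  have h1 := (y.continuous.tendsto _).comp (ProjLattice.tendsto_sSup_apply D x)
  have h2 := ProjLattice.tendsto_sSup_apply D (y x)
  refine tendsto_nhds_unique h1 (h2.congr fun P => ?_)
  exact congrArg (fun A : H →L[ℂ] H => A x) (hD P.2 y hy).symm

namespace COMLIso

variable (τ : COMLIso (ProjLattice M) (ProjLattice N)) (C : Set (ProjLattice M))

/-- The pairs `(P, τ P)` for the projections `P ∈ C`. -/
def graphSet : Set ((H →L[ℂ] H) × (K →L[ℂ] K)) :=
  (fun P : ProjLattice M => (P.val, (τ.toEquiv P).val)) '' C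

/-- The graph of the linear and norm continuous extension of `τ` from `C` to the closed linear
span of `C`. -/
noncomputable def graph : Submodule ℂ ((H →L[ℂ] H) × (K →L[ℂ] K)) :=
  (Submodule.span ℂ (τ.graphSet C)).topologicalClosure

variable {τ C}

theorem span_le_graph : Submodule.span ℂ (τ.graphSet C) ≤ τ.graph C :=
  Submodule.le_topologicalClosure _

theorem mem_graph {P : ProjLattice M} (hP : P ∈ C) : (P.val, (τ.toEquiv P).val) ∈ τ.graph C :=
  span_le_graph (Submodule.subset_span ⟨P, hP, rfl⟩)

theorem isClosed_graph : IsClosed (τ.graph C : Set ((H →L[ℂ] H) × (K →L[ℂ] K))) :=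
  Submodule.isClosed_topologicalClosure _

theorem graph_mono {C' : Set (ProjLattice M)} (h : C ⊆ C') : τ.graph C ≤ τ.graph C' :=
  Submodule.topologicalClosure_mono (Submodule.span_mono (Set.image_mono h))

/-- Induction for closed properties of the elements of the graph. -/
theorem graph_induction {p : (H →L[ℂ] H) × (K →L[ℂ] K) → Prop} (hcl : IsClosed {x | p x})
    (hspan : ∀ x ∈ Submodule.span ℂ (τ.graphSet C), p x) {x} (hx : x ∈ τ.graph C) : p x :=
  closure_minimal hspan hcl hx

/-- The partition is taken in the product algebra, so the same coefficients and the same projections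
serve both coordinates. -/
theorem exists_partition_of_mem_span (hC : IsBooleanFamily C)
    {x} (hx : x ∈ Submodule.span ℂ (τ.graphSet C)) :
    ∃ (ι : Type) (_ : Fintype ι) (a : ι → ℂ) (P : ι → ProjLattice M), (∀ i, P i ∈ C) ∧
      (∀ i j, i ≠ j → (P i).val * (P j).val = 0) ∧
      (∀ i j, i ≠ j → (τ.toEquiv (P i)).val * (τ.toEquiv (P j)).val = 0) ∧
      ∑ i, (P i).val = 1 ∧ ∑ i, (τ.toEquiv (P i)).val = 1 ∧
      x = ∑ i, a i • ((P i).val, (τ.toEquiv (P i)).val) := by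
  obtain ⟨ι, _, a, q, hq, ho, hs, rfl⟩ := exists_orthogonal_partition_of_mem_span (𝕜 := ℂ)
    (G := τ.graphSet C) ⟨⊤, hC.top_mem, by
      simp only [map_top, ProjLattice.val_top]; rfl⟩ (by
      rintro _ ⟨P, hP, rfl⟩ _ ⟨Q, hQ, rfl⟩
      refine ⟨P ⊓ Q, hC.inf_mem P hP Q hQ, ?_⟩
      simp only [ProjLattice.val_inf (hC.commute P hP Q hQ), val_map_inf τ (hC.commute P hP Q hQ)]
      rfl) (by
      rintro _ ⟨P, hP, rfl⟩
      refine ⟨Pᶜ, hC.compl_mem P hP, ?_⟩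
      simp only [map_compl, ProjLattice.val_compl]
      rfl) (by
      rintro _ ⟨P, hP, rfl⟩
      exact Prod.ext P.mul_self (τ.toEquiv P).mul_self) (by
      rintro _ ⟨P, hP, rfl⟩ _ ⟨Q, hQ, rfl⟩
      exact Prod.ext (hC.commute P hP Q hQ) (τ.commute (hC.commute P hP Q hQ))) hx
  choose P hP hPq using hq
  obtain rfl : (fun i => ((P i).val, (τ.toEquiv (P i)).val)) = q := funext hPq
  refine ⟨ι, inferInstance, a, P, hP, fun i j h => congrArg Prod.fst (ho i j h),
    fun i j h => congrArg Prod.snd (ho i j h), ?_, ?_, rfl⟩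
  · have := congrArg Prod.fst hs
    rwa [Prod.fst_sum] at this
  · have := congrArg Prod.snd hs
    rwa [Prod.snd_sum] at this

/-- On the span both norms are governed by the same coefficients, as `τ` sends exactly the zero
projection to zero. Equality of norms is a closed condition. -/
theorem norm_fst_eq_norm_snd (hC : IsBooleanFamily C) {x} (hx : x ∈ τ.graph C) :
    ‖x.1‖ = ‖x.2‖ := by
  refine graph_induction (p := fun x => ‖x.1‖ = ‖x.2‖)
    (isClosed_eq continuous_fst.norm continuous_snd.norm) (fun x hx => ?_) hx
  obtain ⟨ι, _, a, P, -, ho, ho', hs, hs', rfl⟩ := exists_partition_of_mem_span hC hx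
  rw [Prod.fst_sum, Prod.snd_sum]
  have key : ∀ c : ℝ, 0 ≤ c → (‖∑ i, a i • (P i).val‖ ≤ c ↔
      ‖∑ i, a i • (τ.toEquiv (P i)).val‖ ≤ c) := by
    intro c hc
    rw [norm_sum_smul_projection_le_iff a _ (fun i => (P i).isProj) ho hs hc,
      norm_sum_smul_projection_le_iff a _ (fun i => (τ.toEquiv (P i)).isProj) ho' hs' hc]
    simp only [ne_eq, val_map_eq_zero_iff]
  exact le_antisymm ((key _ (norm_nonneg _)).2 le_rfl) ((key _ (norm_nonneg _)).1 le_rfl)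

theorem graph_unique (hC : IsBooleanFamily C) {A B B'} (h : (A, B) ∈ τ.graph C)
    (h' : (A, B') ∈ τ.graph C) : B = B' := by
  have := norm_fst_eq_norm_snd hC (sub_mem h h')
  simp only [Prod.mk_sub_mk, sub_self, norm_zero] at this
  exact sub_eq_zero.1 (norm_eq_zero.1 this.symm)

theorem mul_mem_graph (hC : IsBooleanFamily C) {x y} (hx : x ∈ τ.graph C)
    (hy : y ∈ τ.graph C) : x * y ∈ τ.graph C := by
  refine map_mem_closure₂ continuous_mul hx hy fun x hx y hy => ?_
  have := Submodule.mul_mem_mul hx hy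
  rw [Submodule.span_mul_span] at this
  refine Submodule.span_mono ?_ this
  rintro _ ⟨_, ⟨P, hP, rfl⟩, _, ⟨Q, hQ, rfl⟩, rfl⟩
  refine ⟨P ⊓ Q, hC.inf_mem P hP Q hQ, ?_⟩
  simp only [ProjLattice.val_inf (hC.commute P hP Q hQ), val_map_inf τ (hC.commute P hP Q hQ)]
  rfl

theorem star_mem_graph {x} (hx : x ∈ τ.graph C) : star x ∈ τ.graph C := by
  refine map_mem_closure continuous_star hx fun x hx => ?_
  induction hx using Submodule.span_induction with
  | mem x hx =>
    obtain ⟨P, hP, rfl⟩ := hx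
    refine Submodule.subset_span ⟨P, hP, ?_⟩
    exact Prod.ext P.star_val.symm (τ.toEquiv P).star_val.symm
  | zero => rw [star_zero]; exact zero_mem _
  | add x y _ _ hx hy => rw [star_add]; exact add_mem hx hy
  | smul c x _ hx => rw [star_smul]; exact Submodule.smul_mem _ _ hx

/-- A centralizer is a closed subalgebra, so commutation of the generators passes to the closed span
in one variable and then in the other. -/
theorem commute_of_mem_graph (hC : IsBooleanFamily C) {x y} (hx : x ∈ τ.graph C)
    (hy : y ∈ τ.graph C) : Commute x y := by
  have h1 : ∀ G : Set ((H →L[ℂ] H) × (K →L[ℂ] K)), τ.graphSet C ⊆ Set.centralizer G →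
      (τ.graph C : Set _) ⊆ Set.centralizer G := fun G hG =>
    closure_minimal (Submodule.span_le (p := Subalgebra.toSubmodule
      (Subalgebra.centralizer ℂ G)).2 hG) (Set.isClosed_centralizer _)
  have h2 : τ.graphSet C ⊆ Set.centralizer (τ.graphSet C) := by
    rintro _ ⟨P, hP, rfl⟩ _ ⟨Q, hQ, rfl⟩
    exact Prod.ext (hC.commute Q hQ P hP) (τ.commute (hC.commute Q hQ P hP))
  have h3 : τ.graphSet C ⊆ Set.centralizer (τ.graph C) := fun g hg z hz => (h1 _ h2 hz g hg).symm
  exact h1 _ h3 hy x hx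

theorem fst_mem_of_mem_graph {x} (hx : x ∈ τ.graph C) : x.1 ∈ M := by
  refine graph_induction (p := fun x => x.1 ∈ M) ?_ (fun x hx => ?_) hx
  · have : IsClosed (M : Set (H →L[ℂ] H)) := by
      rw [← M.centralizer_centralizer]
      exact Set.isClosed_centralizer _
    exact this.preimage continuous_fst
  · refine Submodule.span_le (p := (Subalgebra.toSubmodule
      M.toStarSubalgebra.toSubalgebra).comap (LinearMap.fst ℂ _ _)).2 ?_ hx
    rintro _ ⟨P, -, rfl⟩
    exact P.mem

/-- By this symmetry facts about first coordinates transfer to second coordinates, and the extension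
of `τ.symm` is seen to invert that of `τ`. -/
theorem mem_graph_symm (C' : Set (ProjLattice N)) (h : τ.toEquiv '' C ⊆ C') {x}
    (hx : x ∈ τ.graph C) : x.swap ∈ τ.symm.graph C' := by
  refine map_mem_closure continuous_swap hx fun x hx => ?_
  induction hx using Submodule.span_induction with
  | mem x hx =>
    obtain ⟨P, hP, rfl⟩ := hx
    refine Submodule.subset_span ⟨τ.toEquiv P, h ⟨P, hP, rfl⟩, ?_⟩
    simp [symm_toEquiv]
  | zero => exact zero_mem _
  | add x y _ _ hx hy => rw [Prod.swap_add]; exact add_mem hx hy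
  | smul c x _ hx => exact Submodule.smul_mem _ c hx

theorem snd_mem_of_mem_graph {x} (hx : x ∈ τ.graph C) : x.2 ∈ N :=
  fst_mem_of_mem_graph (mem_graph_symm _ subset_rfl hx)

/-- The domain of the extension is closed. -/
theorem exists_mem_graph_of_mem_closure (hC : IsBooleanFamily C) {A : H →L[ℂ] H}
    (hA : A ∈ closure (Prod.fst '' (τ.graph C : Set ((H →L[ℂ] H) × (K →L[ℂ] K))))) :
    ∃ B, (A, B) ∈ τ.graph C := by
  have : CompleteSpace (τ.graph C) := isClosed_graph.completeSpace_coe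
  let f : τ.graph C →ₗ[ℂ] (H →L[ℂ] H) := LinearMap.fst ℂ _ _ ∘ₗ (τ.graph C).subtype
  -- The product carries the maximum norm and both coordinates have equal norm, so the first
  -- projection is isometric on a complete space and its range is closed.
  have hf : Isometry f := AddMonoidHomClass.isometry_of_norm f fun x => by
    change ‖x.1.1‖ = max ‖x.1.1‖ ‖x.1.2‖
    rw [← norm_fst_eq_norm_snd hC x.2, max_self]
  have hr : Set.range f = Prod.fst '' (τ.graph C : Set ((H →L[ℂ] H) × (K →L[ℂ] K))) := by
    ext; constructor
    · rintro ⟨x, rfl⟩; exact ⟨x, x.2, rfl⟩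
    · rintro ⟨x, hx, rfl⟩; exact ⟨⟨x, hx⟩, rfl⟩
  rw [← hr, hf.isClosedEmbedding.isClosed_range.closure_eq] at hA
  obtain ⟨⟨⟨A', B⟩, hx⟩, rfl⟩ := hA
  exact ⟨B, hx⟩

end COMLIso

end

/-! ### The extension of a lattice isomorphism to normal operators. -/

theorem commute_of_mem_singleton {R : Type*} [Mul R] {A B C : R} (hB : B ∈ ({A} : Set R))
    (hC : C ∈ ({A} : Set R)) : Commute B C := by
  rw [Set.mem_singleton_iff.1 hB, Set.mem_singleton_iff.1 hC]

theorem commute_of_mem_pair {R : Type*} [Mul R] {A B : R} (h : Commute A B) :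
    ∀ X ∈ ({A, B} : Set R), ∀ Y ∈ ({A, B} : Set R), Commute X Y := by
  rintro _ (rfl | rfl) _ (rfl | rfl)
  exacts [Commute.refl _, h, h.symm, Commute.refl _]

section

variable {H K : Type*} [NormedAddCommGroup H] [InnerProductSpace ℂ H] [CompleteSpace H]
  [NormedAddCommGroup K] [InnerProductSpace ℂ K] [CompleteSpace K]
  {M : VonNeumannAlgebra H} {N : VonNeumannAlgebra K}

theorem bicommutantProj_subset {S S' : Set (H →L[ℂ] H)}
    (h : S ⊆ Set.centralizer (Set.centralizer S')) :
    bicommutantProj M S ⊆ bicommutantProj M S' := fun P hP => by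
  have h1 := Set.centralizer_subset h
  rw [Set.centralizer_centralizer_centralizer] at h1
  exact Set.centralizer_subset h1 hP

/-- This is Fuglede's theorem: whatever commutes with a normal operator commutes with its adjoint.
-/
theorem star_mem_bicommutant {A : H →L[ℂ] H} (hA : IsStarNormal A) :
    star A ∈ Set.centralizer (Set.centralizer {A}) := fun _ hy =>
  (hA.commute_star_left (hy A rfl)).symm

theorem bicommutant_subset {A : H →L[ℂ] H} (hA : A ∈ M) :
    Set.centralizer (Set.centralizer {A}) ⊆ (M : Set (H →L[ℂ] H)) := by
  rw [← M.centralizer_centralizer]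
  exact Set.centralizer_subset (Set.centralizer_subset (Set.singleton_subset_iff.2 hA))

/-- A self-adjoint element of `M` is approximated in norm by real-linear combinations of orthogonal
projections of `M` in its bicommutant. -/
theorem exists_orthogonal_norm_sub_le {A : H →L[ℂ] H} (hM : A ∈ M) (hA : IsSelfAdjoint A) (n : ℕ) :
    ∃ (ι : Type) (_ : Fintype ι) (a : ι → ℝ) (P : ι → ProjLattice M),
      (∀ i, P i ∈ bicommutantProj M {A}) ∧ (∀ i j, i ≠ j → (P i).val * (P j).val = 0) ∧
      ‖A - ∑ i, (a i : ℂ) • (P i).val‖ ≤ ‖A‖ / 2 ^ n := by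
  obtain ⟨X, hX, hXn⟩ := exists_mem_span_norm_sub_le A hA n
  have hcomm : ∀ x ∈ Set.centralizer (Set.centralizer {A}),
      ∀ y ∈ Set.centralizer (Set.centralizer {A}), x * y = y * x :=
    Set.centralizer_centralizer_comm_of_comm fun B hB C hC => commute_of_mem_singleton hB hC
  obtain ⟨ι, _, a, q, hq, ho, -, rfl⟩ := exists_orthogonal_partition_of_mem_span
    (G := {P : H →L[ℂ] H | IsStarProjection P ∧ P ∈ Set.centralizer (Set.centralizer {A})})
    ⟨.one _, Set.one_mem_centralizer⟩
    (fun x hx y hy => ⟨hx.1.mul hy.1 (hcomm x hx.2 y hy.2), Set.mul_mem_centralizer hx.2 hy.2⟩)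
    (fun x hx => ⟨hx.1.one_sub, Subalgebra.sub_mem
      (Subalgebra.centralizer ℂ (Set.centralizer {A})) (one_mem _) hx.2⟩)
    (fun x hx => hx.1.isIdempotentElem) (fun x hx y hy => hcomm x hx.2 y hy.2) hX
  refine ⟨ι, inferInstance, a, fun i => ⟨q i, bicommutant_subset hM (hq i).2, (hq i).1⟩,
    fun i => (hq i).2, ho, ?_⟩
  simpa only [Complex.coe_smul] using hXn

theorem exists_seq_isFiniteProjComb (A : NormalPart M) (hA : IsSelfAdjoint A.val) :
    ∃ S : ℕ → NormalPart M, (∀ i, IsFiniteProjComb (S i) ∧ Commute (S i).val A.val) ∧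
      Tendsto (fun i => (S i).val) atTop (𝓝 A.val) := by
  choose ι inst a P hP ho hn using exists_orthogonal_norm_sub_le A.mem hA
  let S (n : ℕ) : NormalPart M :=
    { val := ∑ i, (a n i : ℂ) • (P n i).val
      mem := sum_mem fun i _ => M.toStarSubalgebra.smul_mem (P n i).mem _
      normal := by
        refine IsSelfAdjoint.isStarNormal (isSelfAdjoint_sum _ fun i _ => ?_)
        exact IsSelfAdjoint.smul (Complex.conj_ofReal _) (P n i).isProj.isSelfAdjoint }
  refine ⟨S, fun n => ⟨?_, ?_⟩, ?_⟩
  · let e := (Fintype.equivFin (ι n)).symm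
    refine ⟨Fintype.card (ι n), a n ∘ e, P n ∘ e, fun i j h => ho n _ _ (e.injective.ne h), ?_⟩
    exact (e.sum_comp fun i => (a n i : ℂ) • (P n i).val).symm
  · refine Commute.sum_left _ _ _ fun i _ => Commute.smul_left ?_ _
    exact (hP n i A.val fun B hB => by rw [Set.mem_singleton_iff.1 hB]).symm
  · rw [tendsto_iff_norm_sub_tendsto_zero]
    refine squeeze_zero (fun _ => norm_nonneg _) (fun n => ?_)
      (tendsto_const_nhds.div_atTop (tendsto_pow_atTop_atTop_of_one_lt (one_lt_two (α := ℝ)))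
        : Tendsto (fun n : ℕ => ‖A.val‖ / 2 ^ n) atTop (𝓝 0))
    rw [norm_sub_rev]
    exact hn n

namespace COMLIso

variable (τ : COMLIso (ProjLattice M) (ProjLattice N))

theorem exists_mem_graph_of_isSelfAdjoint {A : H →L[ℂ] H} (hM : A ∈ M) (hA : IsSelfAdjoint A) :
    ∃ B, (A, B) ∈ τ.graph (bicommutantProj M {A}) := by
  refine exists_mem_graph_of_mem_closure
    (isBooleanFamily_bicommutantProj fun B hB C hC => commute_of_mem_singleton hB hC) ?_
  choose ι inst a P hP ho hn using exists_orthogonal_norm_sub_le hM hA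
  refine mem_closure_of_tendsto (b := atTop) (f := fun n : ℕ => ∑ i, (a n i : ℂ) • (P n i).val)
    ?_ (.of_forall fun n => ⟨∑ i, (a n i : ℂ) • ((P n i).val, (τ.toEquiv (P n i)).val),
      sum_mem fun i _ => Submodule.smul_mem _ _ (mem_graph (hP n i)), by simp [Prod.fst_sum]⟩)
  rw [tendsto_iff_norm_sub_tendsto_zero]
  refine squeeze_zero (fun _ => norm_nonneg _) (fun n => ?_)
    (tendsto_const_nhds.div_atTop (tendsto_pow_atTop_atTop_of_one_lt (one_lt_two (α := ℝ)))
      : Tendsto (fun n : ℕ => ‖A‖ / 2 ^ n) atTop (𝓝 0))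
  rw [norm_sub_rev]
  exact hn n

/-- By Fuglede the real and imaginary parts lie in the bicommutant of `A`, so the self-adjoint case
applies inside one graph. The image is normal because the graph is commutative and closed under
`star`. -/
theorem exists_mem_graph (A : NormalPart M) :
    ∃ B : NormalPart N, (A.val, B.val) ∈ τ.graph (bicommutantProj M {A.val}) := by
  have hbool : IsBooleanFamily (bicommutantProj M {A.val}) :=
    isBooleanFamily_bicommutantProj fun B hB C hC => commute_of_mem_singleton hB hC
  suffices ∃ B, (A.val, B) ∈ τ.graph (bicommutantProj M {A.val}) by
    obtain ⟨B, hB⟩ := this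
    refine ⟨⟨B, snd_mem_of_mem_graph hB, ⟨?_⟩⟩, hB⟩
    exact congrArg Prod.snd (commute_of_mem_graph hbool (star_mem_graph hB) hB).eq
  have hself : A.val ∈ Set.centralizer (Set.centralizer {A.val}) :=
    Set.subset_centralizer_centralizer rfl
  have hstar := star_mem_bicommutant A.normal
  have hre : (realPart A.val : H →L[ℂ] H) ∈ Set.centralizer (Set.centralizer {A.val}) := by
    rw [realPart_apply_coe]
    exact Subalgebra.smul_mem (Subalgebra.centralizer ℝ (Set.centralizer {A.val}))
      (add_mem hself hstar) _
  have him : (imaginaryPart A.val : H →L[ℂ] H) ∈ Set.centralizer (Set.centralizer {A.val}) := by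
    rw [imaginaryPart_apply_coe]
    exact Subalgebra.smul_mem (Subalgebra.centralizer ℂ (Set.centralizer {A.val}))
      (Subalgebra.smul_mem (Subalgebra.centralizer ℝ (Set.centralizer {A.val}))
        (Subalgebra.sub_mem _ hself hstar) _) _
  obtain ⟨B₁, h₁⟩ := τ.exists_mem_graph_of_isSelfAdjoint (bicommutant_subset A.mem hre)
    (realPart A.val).2
  obtain ⟨B₂, h₂⟩ := τ.exists_mem_graph_of_isSelfAdjoint (bicommutant_subset A.mem him)
    (imaginaryPart A.val).2
  have h₁' := graph_mono (bicommutantProj_subset (Set.singleton_subset_iff.2 hre)) h₁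
  have h₂' := graph_mono (bicommutantProj_subset (Set.singleton_subset_iff.2 him)) h₂
  have := add_mem h₁' (Submodule.smul_mem _ Complex.I h₂')
  rw [Prod.smul_mk, Prod.mk_add_mk, realPart_add_I_smul_imaginaryPart] at this
  exact ⟨_, this⟩

/-- The extension of an isomorphism of projection lattices to the normal operators. -/
noncomputable def extend (A : NormalPart M) : NormalPart N := (τ.exists_mem_graph A).choose

theorem extend_mem_graph_singleton (A : NormalPart M) :
    (A.val, (τ.extend A).val) ∈ τ.graph (bicommutantProj M {A.val}) :=
  (τ.exists_mem_graph A).choose_spec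

theorem extend_mem_graph {A : NormalPart M} {S : Set (H →L[ℂ] H)}
    (hA : A.val ∈ Set.centralizer (Set.centralizer S)) :
    (A.val, (τ.extend A).val) ∈ τ.graph (bicommutantProj M S) :=
  graph_mono (bicommutantProj_subset (Set.singleton_subset_iff.2 hA))
    (τ.extend_mem_graph_singleton A)

/-- `extend` is chosen inside the bicommutant of `A` alone, but any commuting set `S` whose
bicommutant contains `A` computes it. Laws for a commuting pair follow with `S = {A, B}`. -/
theorem extend_eq {A : NormalPart M} {S : Set (H →L[ℂ] H)}
    (hS : ∀ A ∈ S, ∀ B ∈ S, Commute A B) (hA : A.val ∈ Set.centralizer (Set.centralizer S))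
    {B : K →L[ℂ] K} (hB : (A.val, B) ∈ τ.graph (bicommutantProj M S)) : (τ.extend A).val = B :=
  graph_unique (isBooleanFamily_bicommutantProj hS) (τ.extend_mem_graph hA) hB

theorem extend_toNormalPart (P : ProjLattice M) :
    (τ.extend P.toNormalPart).val = (τ.toEquiv P).val :=
  τ.extend_eq (A := P.toNormalPart) (S := {P.val})
    (fun _ hB _ hC => commute_of_mem_singleton hB hC) (Set.subset_centralizer_centralizer rfl)
    (mem_graph (mem_bicommutantProj rfl))

theorem extend_sum {n : ℕ} (a : Fin n → ℂ) (P : Fin n → ProjLattice M) (A : NormalPart M)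
    (hP : ∀ i j, Commute (P i).val (P j).val) (hA : A.val = ∑ i, a i • (P i).val) :
    (τ.extend A).val = ∑ i, a i • (τ.toEquiv (P i)).val := by
  refine τ.extend_eq (S := Set.range fun i => (P i).val) ?_ ?_ ?_
  · rintro _ ⟨i, rfl⟩ _ ⟨j, rfl⟩
    exact hP i j
  · rw [hA]
    exact Subalgebra.sum_mem (Subalgebra.centralizer ℂ _) fun i _ =>
      Subalgebra.smul_mem (Subalgebra.centralizer ℂ _)
        (Set.subset_centralizer_centralizer (Set.mem_range_self i)) _
  · have : ∑ i, a i • ((P i).val, (τ.toEquiv (P i)).val) ∈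
        τ.graph (bicommutantProj M (Set.range fun i => (P i).val)) :=
      sum_mem fun i _ => Submodule.smul_mem _ _ (mem_graph (mem_bicommutantProj ⟨i, rfl⟩))
    convert this using 1
    refine Prod.ext ?_ ?_
    · simp [Prod.fst_sum, hA]
    · simp [Prod.snd_sum]

theorem norm_extend_sub {A B : NormalPart M} (h : Commute A.val B.val) :
    ‖(τ.extend A).val - (τ.extend B).val‖ = ‖A.val - B.val‖ := by
  have h1 := τ.extend_mem_graph (A := A) (S := {A.val, B.val})
    (Set.subset_centralizer_centralizer (by simp))
  have h2 := τ.extend_mem_graph (A := B) (S := {A.val, B.val})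
    (Set.subset_centralizer_centralizer (by simp))
  exact (norm_fst_eq_norm_snd (isBooleanFamily_bicommutantProj (commute_of_mem_pair h))
    (sub_mem h1 h2)).symm

theorem extend_one : τ.extend 1 = 1 := by
  ext1
  have h : (1 : NormalPart M) = (⊤ : ProjLattice M).toNormalPart := by
    ext1; exact ProjLattice.val_top.symm
  rw [h, extend_toNormalPart, map_top, ProjLattice.val_top]
  rfl

theorem extend_lin (A B : NormalPart M) (h : Commute A.val B.val) (a b : ℂ) :
    (τ.extend (NormalPart.lin a b A B h)).val = a • (τ.extend A).val + b • (τ.extend B).val := by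
  have hA : A.val ∈ Set.centralizer (Set.centralizer {A.val, B.val}) :=
    Set.subset_centralizer_centralizer (by simp)
  have hB : B.val ∈ Set.centralizer (Set.centralizer {A.val, B.val}) :=
    Set.subset_centralizer_centralizer (by simp)
  refine τ.extend_eq (commute_of_mem_pair h) ?_ (add_mem
    (Submodule.smul_mem _ a (τ.extend_mem_graph hA))
    (Submodule.smul_mem _ b (τ.extend_mem_graph hB)))
  exact Subalgebra.add_mem (Subalgebra.centralizer ℂ _)
    (Subalgebra.smul_mem (Subalgebra.centralizer ℂ _) hA a)
    (Subalgebra.smul_mem (Subalgebra.centralizer ℂ _) hB b)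

theorem extend_mul (A B : NormalPart M) (h : Commute A.val B.val) :
    (τ.extend (NormalPart.mul A B h)).val = (τ.extend A).val * (τ.extend B).val := by
  have hA : A.val ∈ Set.centralizer (Set.centralizer {A.val, B.val}) :=
    Set.subset_centralizer_centralizer (by simp)
  have hB : B.val ∈ Set.centralizer (Set.centralizer {A.val, B.val}) :=
    Set.subset_centralizer_centralizer (by simp)
  exact τ.extend_eq (commute_of_mem_pair h) (Set.mul_mem_centralizer hA hB)
    (mul_mem_graph (isBooleanFamily_bicommutantProj (commute_of_mem_pair h))
      (τ.extend_mem_graph hA) (τ.extend_mem_graph hB))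

theorem extend_star (A : NormalPart M) : τ.extend (star A) = star (τ.extend A) := by
  ext1
  have := star_mem_graph (τ.extend_mem_graph_singleton A)
  exact τ.extend_eq (A := star A) (S := {A.val})
    (fun _ hB _ hC => commute_of_mem_singleton hB hC) (star_mem_bicommutant A.normal) this

theorem extend_symm_extend (A : NormalPart M) : τ.symm.extend (τ.extend A) = A := by
  ext1
  have hbool : IsBooleanFamily (bicommutantProj M {A.val}) :=
    isBooleanFamily_bicommutantProj fun B hB C hC => commute_of_mem_singleton hB hC
  have hA := τ.extend_mem_graph_singleton A
  -- This commuting set contains the images of all projections in the bicommutant of `A`, so the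
  -- swapped graph of `τ` lies in the graph of `τ.symm` over it.
  refine τ.symm.extend_eq (S := insert (τ.extend A).val
    ((fun P => (τ.toEquiv P).val) '' bicommutantProj M {A.val})) ?_
    (Set.subset_centralizer_centralizer (Set.mem_insert _ _)) (mem_graph_symm _ ?_ hA)
  · have h1 : ∀ P ∈ bicommutantProj M {A.val},
        Commute (τ.extend A).val (τ.toEquiv P).val := fun P hP =>
      congrArg Prod.snd (commute_of_mem_graph hbool hA (mem_graph hP)).eq
    rintro _ (rfl | ⟨P, hP, rfl⟩) _ (rfl | ⟨Q, hQ, rfl⟩)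
    · exact Commute.refl _
    · exact h1 Q hQ
    · exact (h1 P hP).symm
    · exact τ.commute (hbool.commute P hP Q hQ)
  · rintro _ ⟨P, hP, rfl⟩
    exact mem_bicommutantProj (Set.mem_insert_of_mem _ ⟨P, hP, rfl⟩)

theorem extend_extend_symm (B : NormalPart N) : τ.extend (τ.symm.extend B) = B :=
  τ.symm.extend_symm_extend B

end COMLIso

end

/-! ### Morphisms of partial von Neumann algebras: contractivity and restriction. -/

section

variable {H K : Type*} [NormedAddCommGroup H] [InnerProductSpace ℂ H] [CompleteSpace H]
  [NormedAddCommGroup K] [InnerProductSpace ℂ K] [CompleteSpace K]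
  {M : VonNeumannAlgebra H} {N : VonNeumannAlgebra K}

theorem NormalPart.val_one : (1 : NormalPart M).val = 1 := rfl

/-- A self-adjoint operator `D` has a self-adjoint `R` in its bicommutant with
`R ^ 2 + D ^ 2 = ‖D‖ ^ 2`. -/
theorem exists_isSelfAdjoint_sq_add_sq (D : H →L[ℂ] H) (hD : IsSelfAdjoint D) :
    ∃ R : H →L[ℂ] H, IsSelfAdjoint R ∧ R ∈ Set.centralizer (Set.centralizer {D}) ∧
      R * R + D * D = ((‖D‖ ^ 2 : ℝ) : ℂ) • (1 : H →L[ℂ] H) := by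
  refine ⟨cfc (fun x : ℝ => Real.sqrt (‖D‖ ^ 2 - x ^ 2)) D, cfc_predicate _ _, ?_, ?_⟩
  · intro y hy
    exact ((show Commute D y from hy D rfl).cfc_real _).symm
  · have hc : Continuous fun x : ℝ => Real.sqrt (‖D‖ ^ 2 - x ^ 2) := by fun_prop
    have h1 : D * D = cfc (fun x : ℝ => x * x) D := by
      rw [cfc_mul (fun x : ℝ => x) (fun x => x) D, cfc_id' ℝ D]
    rw [h1, ← cfc_mul _ _ D hc.continuousOn hc.continuousOn,
      ← cfc_add D _ _ (by fun_prop) (by fun_prop), Complex.coe_smul,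
      ← Algebra.algebraMap_eq_smul_one, ← cfc_const (‖D‖ ^ 2) D]
    refine cfc_congr fun x hx => ?_
    have : ‖x‖ ≤ ‖D‖ := IsometricContinuousFunctionalCalculus.norm_spectrum_le D hx
    have h2 : x ^ 2 ≤ ‖D‖ ^ 2 := by
      rw [← sq_abs x]; exact pow_le_pow_left₀ (abs_nonneg x) this 2
    simp only [Real.mul_self_sqrt (sub_nonneg.2 h2)]
    ring

theorem norm_le_of_sq_add_sq_eq {R D : H →L[ℂ] H} (hR : IsSelfAdjoint R) (hD : IsSelfAdjoint D)
    {c : ℝ} (hc : 0 ≤ c) (h : R * R + D * D = ((c ^ 2 : ℝ) : ℂ) • (1 : H →L[ℂ] H)) : ‖D‖ ≤ c := by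
  refine D.opNorm_le_bound hc fun x => ?_
  have h1 : ∀ A : H →L[ℂ] H, IsSelfAdjoint A → ⟪x, (A * A) x⟫_ℂ = ((‖A x‖ ^ 2 : ℝ) : ℂ) := by
    intro A hA
    have : ⟪A x, A x⟫_ℂ = ⟪x, A (A x)⟫_ℂ := hA.isSymmetric x (A x)
    rw [mul_apply_eq_comp, ← this, inner_self_eq_norm_sq_to_K]
    push_cast
    rfl
  have h2 := congrArg (fun A : H →L[ℂ] H => ⟪x, A x⟫_ℂ) h
  simp only [add_apply, inner_add_right, h1 R hR, h1 D hD, smul_apply, one_apply_eq_self,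
    inner_smul_right] at h2
  rw [inner_self_eq_norm_sq_to_K] at h2
  have h3 : ((‖R x‖ ^ 2 : ℝ) : ℂ) + ((‖D x‖ ^ 2 : ℝ) : ℂ) = ((c ^ 2 : ℝ) : ℂ) * (‖x‖ : ℂ) ^ 2 := h2
  have h4 : ‖R x‖ ^ 2 + ‖D x‖ ^ 2 = c ^ 2 * ‖x‖ ^ 2 := by exact_mod_cast h3
  refine le_of_sq_le_sq ?_ (by positivity)
  rw [mul_pow, ← h4]
  exact le_add_of_nonneg_left (by positivity)

namespace IsPartialVNMorphism

variable {T T' : NormalPart M → NormalPart N}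

/-- Only the underlying operator of `X` matters, so `map_lin` becomes usable for elements not
literally built by `lin`. -/
theorem val_eq_of_val_eq_lin (hT : IsPartialVNMorphism T) {A B X : NormalPart M} {a b : ℂ}
    (h : Commute A.val B.val) (hX : X.val = a • A.val + b • B.val) :
    (T X).val = a • (T A).val + b • (T B).val := by
  rw [← hT.map_lin A B h]
  congr 2
  ext1
  exact hX

theorem val_eq_of_val_eq_mul (hT : IsPartialVNMorphism T) {A B X : NormalPart M}
    (h : Commute A.val B.val) (hX : X.val = A.val * B.val) :
    (T X).val = (T A).val * (T B).val := by
  rw [← hT.map_mul A B h]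
  congr 2
  ext1
  exact hX

theorem isSelfAdjoint (hT : IsPartialVNMorphism T) {A : NormalPart M}
    (hA : IsSelfAdjoint A.val) : IsSelfAdjoint (T A).val := by
  have : star A = A := by
    ext1; exact hA
  have h := hT.map_star A
  rw [this] at h
  exact (congrArg NormalPart.val h).symm

theorem commute (hT : IsPartialVNMorphism T) {A B : NormalPart M}
    (h : Commute A.val B.val) : Commute (T A).val (T B).val := by
  have h1 := hT.map_mul A B h
  rw [hT.val_eq_of_val_eq_mul h.symm (show (NormalPart.mul A B h).val = _ from h)] at h1
  exact h1.symm

theorem map_zero (hT : IsPartialVNMorphism T) {A : NormalPart M} (hA : A.val = 0) :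
    (T A).val = 0 := by
  rw [hT.val_eq_of_val_eq_lin (a := 0) (b := 0) (Commute.refl A.val) (by simp [hA])]
  simp

/-- A morphism is contractive on commuting self-adjoint elements. -/
theorem norm_sub_le (hT : IsPartialVNMorphism T) {A B : NormalPart M} (hA : IsSelfAdjoint A.val)
    (hB : IsSelfAdjoint B.val) (h : Commute A.val B.val) :
    ‖(T A).val - (T B).val‖ ≤ ‖A.val - B.val‖ := by
  let D : NormalPart M := ⟨A.val - B.val, sub_mem A.mem B.mem, (hA.sub hB).isStarNormal⟩
  have hD : IsSelfAdjoint D.val := hA.sub hB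
  obtain ⟨R, hR, hRD, hsq⟩ := exists_isSelfAdjoint_sq_add_sq D.val hD
  let R' : NormalPart M := ⟨R, bicommutant_subset D.mem hRD, hR.isStarNormal⟩
  have hTD : (T D).val = (T A).val - (T B).val := by
    rw [hT.val_eq_of_val_eq_lin (a := 1) (b := -1) h (by simp [D, sub_eq_add_neg])]
    simp [sub_eq_add_neg]
  have hc : Commute (R * R) (D.val * D.val) := by
    have : Commute D.val R := hRD _ fun y hy => by rw [Set.mem_singleton_iff.1 hy]
    exact (this.symm.mul_right this.symm).mul_left (this.symm.mul_right this.symm)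
  -- Applying `T` to `R² + D² = ‖D‖² · 1` gives the same identity for the images, which bounds `T
  -- D`. The scalar operator is encoded as `lin c 0 1 1`.
  have key := hT.val_eq_of_val_eq_lin (X := NormalPart.lin ((‖D.val‖ ^ 2 : ℝ) : ℂ) 0 1 1
    (Commute.refl _)) (A := NormalPart.mul R' R' (Commute.refl _))
    (B := NormalPart.mul D D (Commute.refl _)) (a := 1) (b := 1) hc (by
      simp only [one_smul]
      refine Eq.trans ?_ hsq.symm
      simp [NormalPart.lin, NormalPart.val_one])
  rw [hT.map_lin, hT.map_mul, hT.map_mul, hT.map_one, NormalPart.val_one, zero_smul, add_zero,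
    one_smul, one_smul] at key
  rw [← hTD]
  exact norm_le_of_sq_add_sq_eq (hT.isSelfAdjoint (A := R') hR) (hT.isSelfAdjoint hD)
    (norm_nonneg _) key.symm

theorem map_sum (hT : IsPartialVNMorphism T) {ι : Type*} (s : Finset ι) (a : ι → ℂ)
    (P : ι → NormalPart M) (hP : ∀ i j, Commute (P i).val (P j).val) (A : NormalPart M)
    (hA : A.val = ∑ i ∈ s, a i • (P i).val) : (T A).val = ∑ i ∈ s, a i • (T (P i)).val := by
  classical
  induction s using Finset.induction_on generalizing A with
  | empty => simpa using hT.map_zero (by simpa using hA)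
  | insert i s hi ih =>
    have hn : IsStarNormal (∑ j ∈ s, a j • (P j).val) := by
      constructor
      rw [star_sum]
      refine Commute.sum_left _ _ _ fun j _ => Commute.sum_right _ _ _ fun k _ => ?_
      rw [star_smul]
      exact (((P j).normal.commute_star_left (hP j k)).smul_left _).smul_right _
    let B : NormalPart M := ⟨∑ j ∈ s, a j • (P j).val,
      sum_mem fun j _ => M.toStarSubalgebra.smul_mem (P j).mem _, hn⟩
    have hc : Commute (P i).val B.val :=
      Commute.sum_right _ _ _ fun j _ => (hP i j).smul_right _
    rw [Finset.sum_insert hi] at hA ⊢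
    rw [hT.val_eq_of_val_eq_lin (a := a i) (b := 1) hc (by rw [hA, one_smul]), ih B rfl, one_smul]

/-- Agreement spreads from projections to finite combinations, then by contractivity to self-adjoint
norm limits, and finally to normal operators through their commuting real and imaginary parts. -/
theorem eq_of_eq_on_projections (hT : IsPartialVNMorphism T) (hT' : IsPartialVNMorphism T')
    (h : ∀ P : ProjLattice M, (T P.toNormalPart).val = (T' P.toNormalPart).val) : T = T' := by
  have hfin : ∀ A : NormalPart M, IsFiniteProjComb A → (T A).val = (T' A).val := by
    rintro A ⟨n, a, P, ho, hA⟩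
    have hc : ∀ i j, Commute (P i).toNormalPart.val (P j).toNormalPart.val := by
      intro i j
      by_cases hij : i = j
      · rw [hij]
      · exact (ho i j hij).trans (ho j i (Ne.symm hij)).symm
    rw [hT.map_sum Finset.univ (fun i => (a i : ℂ)) (fun i => (P i).toNormalPart) hc A hA,
      hT'.map_sum Finset.univ (fun i => (a i : ℂ)) (fun i => (P i).toNormalPart) hc A hA]
    simp only [h]
  have hlim : ∀ {T : NormalPart M → NormalPart N}, IsPartialVNMorphism T → ∀ A : NormalPart M,
      IsSelfAdjoint A.val → ∀ S : ℕ → NormalPart M,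
      (∀ i, IsFiniteProjComb (S i) ∧ Commute (S i).val A.val) →
      Tendsto (fun i => (S i).val) atTop (𝓝 A.val) →
      Tendsto (fun i => (T (S i)).val) atTop (𝓝 (T A).val) := by
    intro T hT A hA S hS hSA
    rw [tendsto_iff_norm_sub_tendsto_zero] at hSA ⊢
    refine squeeze_zero (fun _ => norm_nonneg _) (fun i => hT.norm_sub_le ?_ hA (hS i).2) hSA
    obtain ⟨n, a, P, -, hA⟩ := (hS i).1
    rw [hA]
    exact isSelfAdjoint_sum _ fun j _ =>
      IsSelfAdjoint.smul (Complex.conj_ofReal _) (P j).isProj.isSelfAdjoint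
  have hsa : ∀ A : NormalPart M, IsSelfAdjoint A.val → (T A).val = (T' A).val := by
    intro A hA
    obtain ⟨S, hS, hSA⟩ := exists_seq_isFiniteProjComb A hA
    refine tendsto_nhds_unique (hlim hT A hA S hS hSA) ((hlim hT' A hA S hS hSA).congr fun i => ?_)
    exact (hfin _ (hS i).1).symm
  funext A
  ext1
  have hre : (realPart A.val : H →L[ℂ] H) ∈ M := by
    rw [realPart_apply_coe]
    exact M.toStarSubalgebra.smul_mem (add_mem A.mem (star_mem A.mem)) ((2⁻¹ : ℝ) : ℂ)
  have him : (imaginaryPart A.val : H →L[ℂ] H) ∈ M := by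
    rw [imaginaryPart_apply_coe]
    exact M.toStarSubalgebra.smul_mem
      (M.toStarSubalgebra.smul_mem (sub_mem A.mem (star_mem A.mem)) ((2⁻¹ : ℝ) : ℂ)) _
  have hc : Commute (realPart A.val : H →L[ℂ] H) (imaginaryPart A.val : H →L[ℂ] H) := by
    exact isStarNormal_iff_commute_realPart_imaginaryPart.1 A.normal
  let A₁ : NormalPart M := ⟨_, hre, (realPart A.val).2.isStarNormal⟩
  let A₂ : NormalPart M := ⟨_, him, (imaginaryPart A.val).2.isStarNormal⟩
  have hA : A.val = (1 : ℂ) • A₁.val + Complex.I • A₂.val := by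
    rw [one_smul]
    exact (realPart_add_I_smul_imaginaryPart A.val).symm
  rw [hT.val_eq_of_val_eq_lin hc hA, hT'.val_eq_of_val_eq_lin hc hA,
    hsa A₁ (realPart A.val).2, hsa A₂ (imaginaryPart A.val).2]

/-- The restriction of a morphism to the projections. -/
def mapProj (hT : IsPartialVNMorphism T) (P : ProjLattice M) : ProjLattice N where
  val := (T P.toNormalPart).val
  mem := (T P.toNormalPart).mem
  isProj :=
    { isIdempotentElem :=
        (hT.val_eq_of_val_eq_mul (Commute.refl P.toNormalPart.val) P.mul_self.symm).symm
      isSelfAdjoint := hT.isSelfAdjoint (A := P.toNormalPart) P.isProj.isSelfAdjoint }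

theorem mapProj_mono (hT : IsPartialVNMorphism T) : Monotone hT.mapProj := by
  intro P Q h
  have h1 := hT.val_eq_of_val_eq_mul (A := Q.toNormalPart) (B := P.toNormalPart)
    (X := P.toNormalPart) (ProjLattice.commute_of_le h).symm (ProjLattice.le_iff_mul.1 h).symm
  exact ProjLattice.le_iff_mul.2 h1.symm

theorem mapProj_compl (hT : IsPartialVNMorphism T) (P : ProjLattice M) :
    hT.mapProj Pᶜ = (hT.mapProj P)ᶜ := by
  ext1
  have h1 := hT.val_eq_of_val_eq_lin (A := 1) (B := P.toNormalPart)
    (X := Pᶜ.toNormalPart) (a := 1) (b := -1) (Commute.one_left _) (by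
      rw [one_smul, neg_one_smul, ← sub_eq_add_neg]; rfl)
  rw [one_smul, neg_one_smul, ← sub_eq_add_neg, hT.map_one] at h1
  exact h1

end IsPartialVNMorphism

namespace PartialVNIso

theorem toEquiv_injective :
    Function.Injective (toEquiv : PartialVNIso M N → NormalPart M ≃ NormalPart N) := by
  rintro ⟨e, _⟩ ⟨f, _⟩ rfl; rfl

/-- The restriction of an isomorphism of partial von Neumann algebras to the projections. -/
noncomputable def restrict (T : PartialVNIso M N) : COMLIso (ProjLattice M) (ProjLattice N) :=
  COMLIso.ofOrderIso
    { toFun := T.isMorphism.mapProj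
      invFun := T.isMorphism_symm.mapProj
      left_inv := fun P => ProjLattice.ext <|
        congrArg NormalPart.val (T.toEquiv.symm_apply_apply P.toNormalPart)
      right_inv := fun P => ProjLattice.ext <|
        congrArg NormalPart.val (T.toEquiv.apply_symm_apply P.toNormalPart)
      map_rel_iff' := by
        intro P Q
        refine ⟨fun h => ?_, fun h => T.isMorphism.mapProj_mono h⟩
        have h1 : ∀ P, T.isMorphism_symm.mapProj (T.isMorphism.mapProj P) = P := fun P =>
          ProjLattice.ext <|
            congrArg NormalPart.val (T.toEquiv.symm_apply_apply P.toNormalPart)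
        rw [← h1 P, ← h1 Q]
        exact T.isMorphism_symm.mapProj_mono h }
    T.isMorphism.mapProj_compl

theorem restrict_apply (T : PartialVNIso M N) (P : ProjLattice M) :
    (T.restrict.toEquiv P).val = (T.toEquiv P.toNormalPart).val := rfl

end PartialVNIso

end

/-! ### Normal charges on Boolean algebras of projections. -/

section

variable {H K : Type*} [NormedAddCommGroup H] [InnerProductSpace ℂ H] [CompleteSpace H]
  [NormedAddCommGroup K] [InnerProductSpace ℂ K] [CompleteSpace K]
  {M : VonNeumannAlgebra H} {N : VonNeumannAlgebra K}

/-- A Boolean algebra of commuting projections which contains the suprema of its chains. -/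
structure IsChainCompleteFamily (C : Set (ProjLattice M)) : Prop extends IsBooleanFamily C where
  sSup_mem : ∀ D ⊆ C, IsChain (· ≤ ·) D → D.Nonempty → sSup D ∈ C

theorem isChainCompleteFamily_bicommutantProj {S : Set (H →L[ℂ] H)}
    (hS : ∀ A ∈ S, ∀ B ∈ S, Commute A B) : IsChainCompleteFamily (bicommutantProj M S) where
  toIsBooleanFamily := isBooleanFamily_bicommutantProj hS
  sSup_mem _ hD hc hne := sSup_mem_bicommutantProj hD hc hne

/-- A signed normal charge on a family of commuting projections. -/
structure IsNormalCharge (C : Set (ProjLattice M)) (φ : ProjLattice M → ℝ) : Prop where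
  add_compl : ∀ P ∈ C, ∀ Q ∈ C, φ (P ⊓ Q) + φ (P ⊓ Qᶜ) = φ P
  tendsto_sSup : ∀ D ⊆ C, IsChain (· ≤ ·) D → D.Nonempty →
    Tendsto (fun P : D => φ P) atTop (𝓝 (φ (sSup D)))

namespace IsNormalCharge

variable {C : Set (ProjLattice M)} {φ ψ : ProjLattice M → ℝ}

theorem sub (hφ : IsNormalCharge C φ) (hψ : IsNormalCharge C ψ) :
    IsNormalCharge C fun P => φ P - ψ P where
  add_compl P hP Q hQ := by
    rw [← hφ.add_compl P hP Q hQ, ← hψ.add_compl P hP Q hQ]; ring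
  tendsto_sSup D hD hc hne := (hφ.tendsto_sSup D hD hc hne).sub (hψ.tendsto_sSup D hD hc hne)

theorem neg (hφ : IsNormalCharge C φ) : IsNormalCharge C fun P => -φ P where
  add_compl P hP Q hQ := by
    rw [← hφ.add_compl P hP Q hQ]; ring
  tendsto_sSup D hD hc hne := (hφ.tendsto_sSup D hD hc hne).neg

theorem tsum {φ : ℕ → ProjLattice M → ℝ} (hφ : ∀ n, IsNormalCharge C (φ n)) {b : ℕ → ℝ}
    (hb : Summable b) (hφb : ∀ n P, ‖φ n P‖ ≤ b n) :
    IsNormalCharge C fun P => ∑' n, φ n P where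
  add_compl P hP Q hQ := by
    have hs (P) : Summable fun n => φ n P := Summable.of_norm_bounded hb fun n => hφb n P
    rw [← (hs _).tsum_add (hs _)]
    simp only [(hφ _).add_compl P hP Q hQ]
  tendsto_sSup D hD hc hne := tendsto_tsum_of_dominated_convergence hb
    (fun n => (hφ n).tendsto_sSup D hD hc hne) (.of_forall fun P n => hφb n P)

theorem map_bot (hφ : IsNormalCharge C φ) (hC : IsBooleanFamily C) : φ ⊥ = 0 := by
  have hb : (⊥ : ProjLattice M) ∈ C := by
    rw [← ProjLattice.inf_compl ⊤]
    exact hC.inf_mem _ hC.top_mem _ (hC.compl_mem _ hC.top_mem)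
  have := hφ.add_compl ⊥ hb ⊥ hb
  rw [bot_inf_eq, bot_inf_eq] at this
  linarith

theorem mono (hφ : IsNormalCharge C φ) (hC : IsBooleanFamily C) (h0 : ∀ P ∈ C, 0 ≤ φ P)
    {P Q : ProjLattice M} (hP : P ∈ C) (hQ : Q ∈ C) : φ (P ⊓ Q) ≤ φ P := by
  rw [← hφ.add_compl P hP Q hQ]
  exact le_add_of_nonneg_right (h0 _ (hC.inf_mem _ hP _ (hC.compl_mem _ hQ)))

/-- A projection which is maximal among those of nonnegative charge. -/
theorem exists_maximal_nonneg (hφ : IsNormalCharge C φ) (hC : IsChainCompleteFamily C) :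
    ∃ G ∈ C, 0 ≤ φ G ∧ ∀ F ∈ C, F ≤ Gᶜ → 0 ≤ φ F → F = ⊥ := by
  -- Chains have upper bounds because the charge is continuous along them, so their suprema keep
  -- nonnegative charge.
  obtain ⟨G, hG⟩ := zorn_le₀ {P | P ∈ C ∧ 0 ≤ φ P} (by
    intro D hD hc
    rcases D.eq_empty_or_nonempty with rfl | hne
    · refine ⟨⊥, ⟨?_, (hφ.map_bot hC.toIsBooleanFamily).ge⟩, by simp⟩
      rw [← ProjLattice.inf_compl ⊤]
      exact hC.inf_mem _ hC.top_mem _ (hC.compl_mem _ hC.top_mem)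
    · have hDC : D ⊆ C := fun P hP => (hD hP).1
      refine ⟨sSup D, ⟨hC.sSup_mem D hDC hc hne, ?_⟩, fun P hP => le_sSup hP⟩
      have := hne.to_subtype
      have : IsDirectedOrder D := ⟨fun a b => (hc.total a.2 b.2).elim
        (fun h => ⟨b, h, le_rfl⟩) fun h => ⟨a, le_rfl, h⟩⟩
      exact ge_of_tendsto' (hφ.tendsto_sSup D hDC hc hne) fun P => (hD P.2).2)
  refine ⟨G, hG.1.1, hG.1.2, fun F hF hFG hF0 => ?_⟩
  have hGF : G.val * F.val = 0 := by
    have := ProjLattice.le_compl_iff.1 hFG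
    rwa [(ProjLattice.commute_of_le_compl hFG).eq] at this
  have hsup : G ⊔ F ∈ C := by
    rw [← ProjLattice.compl_compl (G ⊔ F)]
    refine hC.compl_mem _ ?_
    convert hC.inf_mem _ (hC.compl_mem _ hG.1.1) _ (hC.compl_mem _ hF) using 1
    ext1
    rw [ProjLattice.val_compl, ProjLattice.val_sup_of_orthogonal hGF, ProjLattice.val_inf
      (hC.commute _ (hC.compl_mem _ hG.1.1) _ (hC.compl_mem _ hF)), ProjLattice.val_compl,
      ProjLattice.val_compl, sub_mul, mul_sub, mul_sub, hGF]
    simp only [mul_one, one_mul, sub_zero]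
    abel
  have h1 : (G ⊔ F) ⊓ G = G := inf_eq_right.2 le_sup_left
  have h2 : (G ⊔ F) ⊓ Gᶜ = F := by
    ext1
    rw [ProjLattice.val_inf (hC.commute _ hsup _ (hC.compl_mem _ hG.1.1)),
      ProjLattice.val_sup_of_orthogonal hGF, ProjLattice.val_compl, mul_sub, mul_one, add_mul,
      G.mul_self, ProjLattice.le_compl_iff.1 hFG]
    abel
  -- Charge is additive on orthogonal joins, so a further `F` of nonnegative charge could be added
  -- to `G`.
  have h3 : G ⊔ F ≤ G := hG.2 ⟨hsup, by
    rw [← hφ.add_compl _ hsup _ hG.1.1, h1, h2]; exact add_nonneg hG.1.2 hF0⟩ le_sup_left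
  refine bot_unique ?_
  rw [← ProjLattice.inf_compl G]
  exact le_inf (le_sup_right.trans h3) hFG

end IsNormalCharge

namespace ProjLattice

theorem inner_apply_self (P : ProjLattice M) (x : H) :
    ⟪x, P.val x⟫_ℂ = ((‖P.val x‖ ^ 2 : ℝ) : ℂ) := by
  have : ⟪P.val x, P.val x⟫_ℂ = ⟪x, P.val (P.val x)⟫_ℂ :=
    P.isProj.isSelfAdjoint.isSymmetric x (P.val x)
  rw [← mul_apply_eq_comp, mul_self, inner_self_eq_norm_sq_to_K] at this
  rw [← this]
  push_cast
  rfl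

theorem norm_sq_add_compl {P Q : ProjLattice M} (h : Commute P.val Q.val) (x : H) :
    ‖(P ⊓ Q).val x‖ ^ 2 + ‖(P ⊓ Qᶜ).val x‖ ^ 2 = ‖P.val x‖ ^ 2 := by
  have h' : Commute P.val Qᶜ.val := (Commute.one_right _).sub_right h
  have h1 := (P ⊓ Q).inner_apply_self x
  have h2 := (P ⊓ Qᶜ).inner_apply_self x
  have h3 := P.inner_apply_self x
  have h4 : (P ⊓ Q).val x + (P ⊓ Qᶜ).val x = P.val x := by
    rw [val_inf h, val_inf h', val_compl, mul_sub, mul_one, ← add_apply, add_sub_cancel]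
  rw [← h4, inner_add_right, h1, h2] at h3
  rw [← h4]
  exact_mod_cast h3

theorem norm_apply_le (P : ProjLattice M) (x : H) : ‖P.val x‖ ≤ ‖x‖ := by
  have h := norm_sq_add_compl (P := ⊤) (Q := P) (by rw [val_top]; exact Commute.one_left _) x
  rw [top_inf_eq, val_top, one_apply_eq_self] at h
  refine le_of_sq_le_sq ?_ (norm_nonneg _)
  rw [← h]
  exact le_add_of_nonneg_right (by positivity)

end ProjLattice

/-- Continuity along chains rests on `τ` preserving arbitrary joins: the images increase strongly to
the image of the supremum. -/
theorem isNormalCharge_norm_sq_map {C : Set (ProjLattice M)} (hC : IsBooleanFamily C)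
    (τ : COMLIso (ProjLattice M) (ProjLattice N)) (x : K) :
    IsNormalCharge C fun P => ‖(τ.toEquiv P).val x‖ ^ 2 where
  add_compl P hP Q hQ := by
    rw [τ.map_inf, τ.map_inf, τ.map_compl]
    exact ProjLattice.norm_sq_add_compl (τ.commute (hC.commute P hP Q hQ)) x
  tendsto_sSup D hD hc hne := by
    have hm : Monotone fun P : D => τ.toEquiv P := fun P Q h => τ.toOrderIso.monotone h
    have := ProjLattice.tendsto_iSup_apply hm x
    rw [← sSup_image', ← τ.map_sSup] at this
    exact this.norm.pow 2

theorem isNormalCharge_norm_sq {C : Set (ProjLattice M)} (hC : IsBooleanFamily C) (x : H) :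
    IsNormalCharge C fun P => ‖P.val x‖ ^ 2 :=
  isNormalCharge_norm_sq_map hC (COMLIso.ofOrderIso (OrderIso.refl _) fun _ => rfl) x

namespace IsNormalCharge

variable {C : Set (ProjLattice M)} {φ : ProjLattice M → ℝ}

/-- A nonzero positive normal charge dominates a nonzero vector functional. -/
theorem exists_ne_zero_norm_sq_le (hφ : IsNormalCharge C φ) (hC : IsChainCompleteFamily C)
    (h0 : ∀ P ∈ C, 0 ≤ φ P) (htop : 0 < φ ⊤) :
    ∃ z : H, z ≠ 0 ∧ ∀ P ∈ C, ‖P.val z‖ ^ 2 ≤ φ P := by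
  have hB := hC.toIsBooleanFamily
  have hbot := hφ.map_bot hB
  have inf_apply : ∀ {P Q : ProjLattice M}, P ∈ C → Q ∈ C →
      ∀ x, (P ⊓ Q).val x = P.val (Q.val x) := by
    intro P Q hP hQ x
    rw [ProjLattice.val_inf (hC.commute P hP Q hQ)]; rfl
  -- As `φ` is nonnegative on `C`, nonnegativity of `-φ` means that `φ` vanishes, so `Z` is a
  -- maximal `φ`-null projection.
  obtain ⟨Z, hZ, hφZ, hZmax⟩ := hφ.neg.exists_maximal_nonneg hC
  have hZc := hC.compl_mem _ hZ
  obtain ⟨x, hx, hZx⟩ : ∃ x : H, x ≠ 0 ∧ (Zᶜ).val x = x := by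
    have h1 := hφ.add_compl ⊤ hC.top_mem Z hZ
    rw [top_inf_eq, top_inf_eq] at h1
    have h2 : (Zᶜ).val ≠ 0 := by
      intro h
      have : Zᶜ = ⊥ := by ext1; rw [h, ProjLattice.val_bot]
      rw [this, hbot] at h1
      linarith
    obtain ⟨y, hy⟩ : ∃ y, (Zᶜ).val y ≠ 0 := by
      by_contra! h
      exact h2 (ContinuousLinearMap.ext h)
    exact ⟨_, hy, by rw [← mul_apply_eq_comp, ProjLattice.mul_self]⟩
  -- `Y` is maximal among the projections of `C` that kill `x`, so below `Yᶜ` only `⊥` kills `x`.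
  obtain ⟨Y, hY, hYx, hYmax⟩ := (isNormalCharge_norm_sq hB x).neg.exists_maximal_nonneg hC
  have hYc := hC.compl_mem _ hY
  have hYx0 : Y.val x = 0 := by
    have : ‖Y.val x‖ ^ 2 = 0 := le_antisymm (by linarith) (by positivity)
    simpa using this
  have hRx : (Yᶜ).val x = x := by
    change x - Y.val x = x
    rw [hYx0, sub_zero]
  have hφR : 0 < φ Yᶜ := by
    by_contra! hle
    have h1 := hZmax _ (hC.inf_mem _ hYc _ hZc) inf_le_right
      (by linarith [hφ.mono hB h0 hYc hZc])
    have h2 := inf_apply hYc hZc x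
    rw [h1, hZx, hRx, ProjLattice.val_bot] at h2
    exact hx h2.symm
  -- The scaling makes `‖t x‖²` equal to half of `φ Yᶜ`.
  obtain ⟨t, ht, htx⟩ : ∃ t : ℝ, 0 < t ∧ (t * ‖x‖) ^ 2 < φ Yᶜ := by
    have hx' := norm_pos_iff.2 hx
    refine ⟨Real.sqrt (φ Yᶜ / 2) / ‖x‖, by positivity, ?_⟩
    rw [div_mul_cancel₀ _ hx'.ne', Real.sq_sqrt (by positivity)]
    linarith
  set y : H := (t : ℂ) • x with hy
  have hyn : ‖y‖ = t * ‖x‖ := by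
    rw [hy, norm_smul, Complex.norm_real, Real.norm_of_nonneg ht.le]
  -- Hahn decomposition: below `Gᶜ` no nonzero projection of `C` gives the vector functional of `y`
  -- a value at least that of `φ`. The choice of `t` keeps `G` from exhausting `Yᶜ`.
  obtain ⟨G, hG, hGy, hGmax⟩ := ((isNormalCharge_norm_sq hB y).sub hφ).exists_maximal_nonneg hC
  have hGc := hC.compl_mem _ hG
  have hE := hC.inf_mem _ hYc _ hGc
  have hφE : 0 < φ (Yᶜ ⊓ Gᶜ) := by
    have h1 := hφ.add_compl _ hYc _ hG
    have h2 := hφ.mono hB h0 hG hYc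
    rw [inf_comm] at h2
    have h3 : ‖G.val y‖ ^ 2 ≤ (t * ‖x‖) ^ 2 := by
      rw [← hyn]
      exact pow_le_pow_left₀ (norm_nonneg _) (G.norm_apply_le y) 2
    linarith
  have hEx : (Yᶜ ⊓ Gᶜ).val x ≠ 0 := by
    intro h
    rw [hYmax _ hE inf_le_left (by rw [h]; simp), hbot] at hφE
    exact lt_irrefl _ hφE
  refine ⟨(Yᶜ ⊓ Gᶜ).val y, ?_, fun P hP => ?_⟩
  · rw [hy, map_smul]
    exact smul_ne_zero (by exact_mod_cast ht.ne') hEx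
  · rw [← inf_apply hP hE]
    refine le_trans ?_ (hφ.mono hB h0 hP hE)
    by_contra! hlt
    have h1 := hGmax _ (hC.inf_mem _ hP _ hE) (inf_le_right.trans inf_le_right) (by linarith)
    rw [h1, hbot, ProjLattice.val_bot] at hlt
    simp at hlt

theorem norm_sq_le_of_forall_le {z : H} (hC : IsBooleanFamily C)
    (h : ∀ P ∈ C, ‖P.val z‖ ^ 2 ≤ φ P) : ‖z‖ ^ 2 ≤ φ ⊤ := by
  simpa [ProjLattice.val_top] using h ⊤ hC.top_mem

/-- The supremum of `‖z‖²` over dominated vectors need not be attained, so a vector reaching at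
least half of it is taken. This is the greedy choice in the exhaustion. -/
theorem exists_almost_maximal (hC : IsBooleanFamily C) (h0 : ∀ P ∈ C, 0 ≤ φ P) :
    ∃ z : H, (∀ P ∈ C, ‖P.val z‖ ^ 2 ≤ φ P) ∧
      ∀ z' : H, (∀ P ∈ C, ‖P.val z'‖ ^ 2 ≤ φ P) → ‖z'‖ ^ 2 ≤ 2 * ‖z‖ ^ 2 := by
  set s : Set ℝ := {r | ∃ z : H, (∀ P ∈ C, ‖P.val z‖ ^ 2 ≤ φ P) ∧ ‖z‖ ^ 2 = r} with hs
  have hbdd : BddAbove s := ⟨φ ⊤, by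
    rintro _ ⟨z, hz, rfl⟩; exact norm_sq_le_of_forall_le hC hz⟩
  have hzero : ∀ P ∈ C, ‖P.val (0 : H)‖ ^ 2 ≤ φ P := fun P hP => by simpa using h0 P hP
  have hne : s.Nonempty := ⟨_, 0, hzero, rfl⟩
  rcases le_or_gt (sSup s) 0 with h | h
  · refine ⟨0, hzero, fun z' hz' => ?_⟩
    have := (le_csSup hbdd ⟨z', hz', rfl⟩).trans h
    simpa using this
  · obtain ⟨_, ⟨z, hz, rfl⟩, hlt⟩ := exists_lt_of_lt_csSup hne (half_lt_self h)
    refine ⟨z, hz, fun z' hz' => ?_⟩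
    have := le_csSup hbdd ⟨z', hz', rfl⟩
    linarith

/-- A positive normal charge is a countable sum of vector functionals. -/
theorem exists_hasSum_norm_sq (hφ : IsNormalCharge C φ) (hC : IsChainCompleteFamily C)
    (h0 : ∀ P ∈ C, 0 ≤ φ P) :
    ∃ z : ℕ → H, Summable (fun n => ‖z n‖ ^ 2) ∧
      ∀ P ∈ C, HasSum (fun n => ‖(P.val (z n))‖ ^ 2) (φ P) := by
  have hB := hC.toIsBooleanFamily
  let State := {φ : ProjLattice M → ℝ // IsNormalCharge C φ ∧ ∀ P ∈ C, 0 ≤ φ P}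
  choose g hg hgmax using fun s : State => exists_almost_maximal hB s.2.2
  let next (s : State) : State := ⟨fun P => s.1 P - ‖P.val (g s)‖ ^ 2,
    s.2.1.sub (isNormalCharge_norm_sq hB _), fun P hP => sub_nonneg.2 (hg s P hP)⟩
  let Φ (n : ℕ) : State := next^[n] ⟨φ, hφ, h0⟩
  let z (n : ℕ) : H := g (Φ n)
  have hΦ : ∀ n P, (Φ n).1 P = φ P - ∑ k ∈ Finset.range n, ‖P.val (z k)‖ ^ 2 := by
    intro n
    induction n with
    | zero => intro P; simp [Φ]
    | succ n ih =>
      intro P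
      have : Φ (n + 1) = next (Φ n) := Function.iterate_succ_apply' _ _ _
      rw [this, Finset.sum_range_succ, ← sub_sub, ← ih P]
  have hle : ∀ P ∈ C, ∀ n, ∑ k ∈ Finset.range n, ‖P.val (z k)‖ ^ 2 ≤ φ P := fun P hP n => by
    have := (Φ n).2.2 P hP
    rw [hΦ] at this
    linarith
  have hsum : Summable fun n => ‖z n‖ ^ 2 := by
    refine summable_of_sum_range_le (c := φ ⊤) (fun n => by positivity) fun n => ?_
    simpa [ProjLattice.val_top] using hle ⊤ hC.top_mem n
  have hbound : ∀ n (P : ProjLattice M), ‖‖P.val (z n)‖ ^ 2‖ ≤ ‖z n‖ ^ 2 := fun n P => by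
    rw [Real.norm_of_nonneg (by positivity)]
    exact pow_le_pow_left₀ (norm_nonneg _) (P.norm_apply_le _) 2
  have hsumP (P : ProjLattice M) : Summable fun n => ‖P.val (z n)‖ ^ 2 :=
    Summable.of_norm_bounded hsum fun n => hbound n P
  have hψ := hφ.sub (IsNormalCharge.tsum (fun n => isNormalCharge_norm_sq hB (z n)) hsum hbound)
  have hψle : ∀ P n, φ P - ∑' k, ‖P.val (z k)‖ ^ 2 ≤ (Φ n).1 P := fun P n => by
    rw [hΦ]
    exact sub_le_sub_left ((hsumP P).sum_le_tsum _ fun k _ => by positivity) _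
  have hψ0 : ∀ P ∈ C, 0 ≤ φ P - ∑' k, ‖P.val (z k)‖ ^ 2 := fun P hP =>
    sub_nonneg.2 ((hsumP P).tsum_le_of_sum_range_le (hle P hP))
  -- A positive remainder would dominate some `w ≠ 0`. Every stage dominates `w` too, so `‖w‖² ≤ 2‖z
  -- n‖²` for all `n`, while the right side tends to `0`.
  have htop : φ ⊤ - ∑' k, ‖(⊤ : ProjLattice M).val (z k)‖ ^ 2 ≤ 0 := by
    by_contra! hpos
    obtain ⟨w, hw, hwle⟩ := hψ.exists_ne_zero_norm_sq_le hC hψ0 hpos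
    have h1 : ∀ n, ‖w‖ ^ 2 ≤ 2 * ‖z n‖ ^ 2 := fun n =>
      hgmax (Φ n) w fun P hP => (hwle P hP).trans (hψle P n)
    have h2 := ge_of_tendsto' (hsum.tendsto_atTop_zero.const_mul 2) h1
    have h3 : 0 < ‖w‖ ^ 2 := by positivity
    linarith
  refine ⟨z, hsum, fun P hP => ?_⟩
  -- The remainder is nonnegative and monotone, so vanishing at `⊤` makes it vanish on all of `C`.
  have h1 := hψ.mono hB hψ0 hC.top_mem hP
  rw [top_inf_eq] at h1
  rw [(hsumP P).hasSum_iff]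
  linarith [hψ0 P hP]

end IsNormalCharge

end

/-! ### Ultraweak functionals and ultraweak continuity of the extension. -/

theorem lp_summable_norm_sq {E : Type*} [NormedAddCommGroup E]
    (x : lp (fun _ : ℕ => E) 2) : Summable fun n => ‖x n‖ ^ 2 := by
  simpa using (lp.memℓp x).summable (by norm_num)

theorem memlp_two_of_summable {E : Type*} [NormedAddCommGroup E] {x : ℕ → E}
    (h : Summable fun n => ‖x n‖ ^ 2) : Memℓp x 2 :=
  memℓp_gen (by simpa using h)

theorem summable_norm_mul_norm {E : Type*} [NormedAddCommGroup E]
    (x y : lp (fun _ : ℕ => E) 2) : Summable fun n => ‖x n‖ * ‖y n‖ := by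
  refine Summable.of_nonneg_of_le (fun n => by positivity) (fun n => ?_)
    (((lp_summable_norm_sq x).add (lp_summable_norm_sq y)).mul_left (1 / 2))
  nlinarith [sq_nonneg (‖x n‖ - ‖y n‖)]

theorem norm_inner_apply_le {E : Type*} [NormedAddCommGroup E] [InnerProductSpace ℂ E]
    (A : E →L[ℂ] E) (x y : E) : ‖⟪x, A y⟫_ℂ‖ ≤ ‖A‖ * (‖x‖ * ‖y‖) := by
  refine (norm_inner_le_norm _ _).trans ?_
  have := mul_le_mul_of_nonneg_left (A.le_opNorm y) (norm_nonneg x)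
  linarith

section

variable {H K : Type*} [NormedAddCommGroup H] [InnerProductSpace ℂ H] [CompleteSpace H]
  [NormedAddCommGroup K] [InnerProductSpace ℂ K] [CompleteSpace K]
  {M : VonNeumannAlgebra H} {N : VonNeumannAlgebra K}

theorem summable_inner_apply (x y : lp (fun _ : ℕ => H) 2) (A : H →L[ℂ] H) :
    Summable fun n => ⟪x n, A (y n)⟫_ℂ :=
  Summable.of_norm_bounded ((summable_norm_mul_norm x y).mul_left ‖A‖) fun n =>
    norm_inner_apply_le A (x n) (y n)

/-- The functional `A ↦ ∑ₙ ⟪xₙ, A yₙ⟫`. -/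
noncomputable def ultraweakFunctional (x y : lp (fun _ : ℕ => H) 2) : (H →L[ℂ] H) →L[ℂ] ℂ :=
  LinearMap.mkContinuous
    { toFun := fun A => ∑' n, ⟪x n, A (y n)⟫_ℂ
      map_add' := fun A B => by
        simp only [add_apply, inner_add_right]
        exact (summable_inner_apply x y A).tsum_add (summable_inner_apply x y B)
      map_smul' := fun c A => by
        simp only [smul_apply, inner_smul_right, RingHom.id_apply, smul_eq_mul]
        exact tsum_mul_left }
    (∑' n, ‖x n‖ * ‖y n‖) fun A => by
      rw [mul_comm]
      refine (norm_tsum_le_tsum_norm (summable_inner_apply x y A).norm).trans ?_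
      rw [← tsum_mul_left]
      exact (summable_inner_apply x y A).norm.tsum_le_tsum
        (fun n => norm_inner_apply_le A (x n) (y n)) ((summable_norm_mul_norm x y).mul_left _)

theorem ultraweakFunctional_apply (x y : lp (fun _ : ℕ => H) 2) (A : H →L[ℂ] H) :
    ultraweakFunctional x y A = ∑' n, ⟪x n, A (y n)⟫_ℂ := rfl

/-- Only diagonal functionals restrict to positive charges on projections, so continuity is reduced
to them. -/
theorem ultraweakFunctional_polarization (x y : lp (fun _ : ℕ => H) 2) (A : H →L[ℂ] H) :
    ultraweakFunctional x y A =
      1 / 4 * (ultraweakFunctional (x + y) (x + y) A - ultraweakFunctional (x - y) (x - y) A -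
        Complex.I * (ultraweakFunctional (x + Complex.I • y) (x + Complex.I • y) A -
          ultraweakFunctional (x - Complex.I • y) (x - Complex.I • y) A)) := by
  have h (x y : lp (fun _ : ℕ => H) 2) := (summable_inner_apply x y A).hasSum
  refine HasSum.unique (h x y) ?_
  convert! (((h (x + y) (x + y)).sub (h (x - y) (x - y))).sub
    (((h (x + Complex.I • y) (x + Complex.I • y)).sub
      (h (x - Complex.I • y) (x - Complex.I • y))).mul_left Complex.I)).mul_left (1 / 4) using 1
  funext n
  simp only [lp.coeFn_add, lp.coeFn_sub, lp.coeFn_smul, Pi.add_apply, Pi.sub_apply, Pi.smul_apply,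
    map_add, map_sub, map_smul, inner_add_left, inner_add_right, inner_sub_left, inner_sub_right,
    inner_smul_left, inner_smul_right, Complex.conj_I]
  ring_nf
  simp only [Complex.I_sq]
  ring

theorem ultraweakFunctional_self_proj (x : lp (fun _ : ℕ => H) 2) (P : ProjLattice M) :
    ultraweakFunctional x x P.val = ((∑' n, ‖P.val (x n)‖ ^ 2 : ℝ) : ℂ) := by
  rw [ultraweakFunctional_apply, Complex.ofReal_tsum]
  simp only [ProjLattice.inner_apply_self]

namespace COMLIso

variable (τ : COMLIso (ProjLattice M) (ProjLattice N))

/-- The extension of `τ` pulls vector functionals back to vector functionals. -/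
theorem exists_ultraweakFunctional_eq {C : Set (ProjLattice M)} (hC : IsChainCompleteFamily C)
    (x : lp (fun _ : ℕ => K) 2) :
    ∃ z : lp (fun _ : ℕ => H) 2, ∀ w ∈ τ.graph C,
      ultraweakFunctional z z w.1 = ultraweakFunctional x x w.2 := by
  have hφ : IsNormalCharge C fun P => ∑' n, ‖(τ.toEquiv P).val (x n)‖ ^ 2 :=
    IsNormalCharge.tsum (fun n => isNormalCharge_norm_sq_map hC.toIsBooleanFamily τ (x n))
      (lp_summable_norm_sq x) fun n P => by
        rw [Real.norm_of_nonneg (by positivity)]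
        exact pow_le_pow_left₀ (norm_nonneg _) ((τ.toEquiv P).norm_apply_le _) 2
  obtain ⟨z, hz, hzφ⟩ := hφ.exists_hasSum_norm_sq hC fun P _ =>
    tsum_nonneg fun n => by positivity
  let z' : lp (fun _ : ℕ => H) 2 := ⟨z, memlp_two_of_summable hz⟩
  -- Both sides are linear and norm continuous in `w`, so agreement on the pairs `(P, τ P)`
  -- suffices.
  refine ⟨z', fun w hw => graph_induction (p := fun w : (H →L[ℂ] H) × (K →L[ℂ] K) =>
    ultraweakFunctional z' z' w.1 = ultraweakFunctional x x w.2) ?_ (fun w hw => ?_) hw⟩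
  · exact isClosed_eq ((ultraweakFunctional z' z').continuous.comp continuous_fst)
      ((ultraweakFunctional x x).continuous.comp continuous_snd)
  · induction hw using Submodule.span_induction with
    | mem w hw =>
      obtain ⟨P, hP, rfl⟩ := hw
      simp only [ultraweakFunctional_self_proj]
      exact congrArg _ (hzφ P hP).tsum_eq
    | zero => simp
    | add v w _ _ hv hw => simp only [Prod.fst_add, Prod.snd_add, map_add, hv, hw]
    | smul c w _ hw => simp only [Prod.smul_fst, Prod.smul_snd, map_smul, hw]

end COMLIso

theorem continuous_normalPart_iff {X : Type*} [TopologicalSpace X] {f : X → NormalPart M} :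
    Continuous f ↔ ∀ x y : lp (fun _ : ℕ => H) 2,
      Continuous fun t => ultraweakFunctional x y (f t).val := by
  rw [continuous_induced_rng, continuous_iInf_rng]
  simp only [continuous_iInf_rng, continuous_induced_rng]
  rfl

theorem continuous_ultraweakFunctional (x y : lp (fun _ : ℕ => H) 2) :
    Continuous fun A : NormalPart M => ultraweakFunctional x y A.val :=
  continuous_normalPart_iff.1 continuous_id x y

namespace COMLIso

variable (τ : COMLIso (ProjLattice M) (ProjLattice N))

/-- All of `S` lies in the domain of one graph. On it a diagonal functional of the image is an
ultraweak functional of the argument, with a sequence `z` independent of the argument. -/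
theorem continuousOn_extend (S : Set (NormalPart M))
    (hS : ∀ A ∈ S, ∀ B ∈ S, Commute A.val B.val) : ContinuousOn τ.extend S := by
  rw [continuousOn_iff_continuous_domRestrict, continuous_normalPart_iff]
  have hC : IsChainCompleteFamily (bicommutantProj M (NormalPart.val '' S)) :=
    isChainCompleteFamily_bicommutantProj (by
      rintro _ ⟨A, hA, rfl⟩ _ ⟨B, hB, rfl⟩
      exact hS A hA B hB)
  have hdiag : ∀ x : lp (fun _ : ℕ => K) 2,
      Continuous fun A : S => ultraweakFunctional x x (S.domRestrict τ.extend A).val := by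
    intro x
    obtain ⟨z, hz⟩ := τ.exists_ultraweakFunctional_eq hC x
    refine ((continuous_ultraweakFunctional z z).comp continuous_subtype_val).congr fun A => ?_
    exact hz _ (τ.extend_mem_graph (Set.subset_centralizer_centralizer ⟨A, A.2, rfl⟩))
  intro x y
  simp only [ultraweakFunctional_polarization x y]
  exact continuous_const.mul (((hdiag _).sub (hdiag _)).sub
    (continuous_const.mul ((hdiag _).sub (hdiag _))))

theorem isPartialVNMorphism_extend : IsPartialVNMorphism τ.extend where
  map_one := τ.extend_one
  map_lin := τ.extend_lin
  map_mul := τ.extend_mul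
  map_star := τ.extend_star
  normal S hS _ := τ.continuousOn_extend S hS

/-- The extension of an isomorphism of projection lattices to an isomorphism of partial von Neumann
algebras. -/
noncomputable def extendIso : PartialVNIso M N where
  toFun := τ.extend
  invFun := τ.symm.extend
  left_inv := τ.extend_symm_extend
  right_inv := τ.extend_extend_symm
  isMorphism := τ.isPartialVNMorphism_extend
  isMorphism_symm := τ.symm.isPartialVNMorphism_extend

theorem extendIso_apply (A : NormalPart M) : τ.extendIso.toEquiv A = τ.extend A := rfl

end COMLIso

/-! ### The bijection and its description. -/

/-- The real and imaginary parts of a normal operator commute. -/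
theorem commute_of_isStarNormal {A B : H →L[ℂ] H} (hA : IsSelfAdjoint A) (hB : IsSelfAdjoint B)
    (h : IsStarNormal (A + Complex.I • B)) : Commute A B := by
  have h1 := h.star_comm_self.eq
  rw [star_add, star_smul, hA.star_eq, hB.star_eq, Complex.star_def, Complex.conj_I] at h1
  have h2 : (2 * Complex.I) • (A * B - B * A) = 0 := by
    rw [← sub_eq_zero.2 h1]
    simp only [add_mul, mul_add, smul_mul_assoc, mul_smul_comm]
    module
  have h3 : (2 * Complex.I) ≠ 0 := by simp
  exact sub_eq_zero.1 ((smul_eq_zero.1 h2).resolve_left h3)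

/-- Restriction to the projections is a bijection from the isomorphisms of partial von Neumann
algebras onto the isomorphisms of projection lattices. -/
noncomputable def restrictEquiv (M : VonNeumannAlgebra H) (N : VonNeumannAlgebra K) :
    PartialVNIso M N ≃ COMLIso (ProjLattice M) (ProjLattice N) where
  toFun T := T.restrict
  invFun τ := τ.extendIso
  left_inv T := by
    refine PartialVNIso.toEquiv_injective (Equiv.ext fun A => ?_)
    refine congrFun (f := T.restrict.extend) (g := T.toEquiv)
      (T.restrict.isPartialVNMorphism_extend.eq_of_eq_on_projections T.isMorphism fun P => ?_) A
    rw [COMLIso.extend_toNormalPart, PartialVNIso.restrict_apply]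
  right_inv τ := by
    refine COMLIso.toEquiv_injective (Equiv.ext fun P => ?_)
    ext1
    rw [PartialVNIso.restrict_apply, COMLIso.extendIso_apply, COMLIso.extend_toNormalPart]

end

theorem mainTheorem7 {H K : Type*}
    [NormedAddCommGroup H] [InnerProductSpace ℂ H] [CompleteSpace H]
    [NormedAddCommGroup K] [InnerProductSpace ℂ K] [CompleteSpace K]
    (M : VonNeumannAlgebra H) (N : VonNeumannAlgebra K) :
    (∃ Φ : PartialVNIso M N ≃ COMLIso (ProjLattice M) (ProjLattice N),
      -- the forward map is restriction to the projections
      (∀ (T : PartialVNIso M N) (P : ProjLattice M),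
        ((Φ T).toEquiv P).val = (T.toEquiv P.toNormalPart).val) ∧
      -- the backward map is the extension by finite combinations, norm limits and linearity
      (∀ τ : COMLIso (ProjLattice M) (ProjLattice N),
        (∀ (n : ℕ) (a : Fin n → ℝ) (P : Fin n → ProjLattice M) (A : NormalPart M),
          (∀ i j, Commute (P i).val (P j).val) → A.val = ∑ i, (a i : ℂ) • (P i).val →
          ((Φ.symm τ).toEquiv A).val = ∑ i, (a i : ℂ) • (τ.toEquiv (P i)).val) ∧
        (∀ A : NormalPart M, IsSelfAdjoint A.val →
          (∃ S : ℕ → NormalPart M,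
            (∀ i, IsFiniteProjComb (S i) ∧ Commute (S i).val A.val) ∧
            Tendsto (fun i => (S i).val) atTop (𝓝 A.val)) ∧
          (∀ S : ℕ → NormalPart M,
            (∀ i, IsFiniteProjComb (S i) ∧ Commute (S i).val A.val) →
            Tendsto (fun i => (S i).val) atTop (𝓝 A.val) →
            Tendsto (fun i => ((Φ.symm τ).toEquiv (S i)).val) atTop
              (𝓝 ((Φ.symm τ).toEquiv A).val))) ∧
        (∀ A₁ A₂ B : NormalPart M, IsSelfAdjoint A₁.val → IsSelfAdjoint A₂.val →
          B.val = A₁.val + Complex.I • A₂.val →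
          ((Φ.symm τ).toEquiv B).val =
            ((Φ.symm τ).toEquiv A₁).val + Complex.I • ((Φ.symm τ).toEquiv A₂).val))) ∧
    (Nonempty (PartialVNIso M N) ↔ Nonempty (COMLIso (ProjLattice M) (ProjLattice N))) := by
  refine ⟨⟨restrictEquiv M N, fun T P => T.restrict_apply P, fun τ => ⟨?_, ?_, ?_⟩⟩,
    (restrictEquiv M N).nonempty_congr⟩
  · intro n a P A hP hA
    exact τ.extend_sum (fun i => (a i : ℂ)) P A hP hA
  · intro A hA
    refine ⟨exists_seq_isFiniteProjComb A hA, fun S hS hSA => ?_⟩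
    rw [tendsto_iff_norm_sub_tendsto_zero] at hSA ⊢
    -- The extension preserves distances between commuting operators, so the two norm sequences
    -- coincide.
    exact hSA.congr fun i => (τ.norm_extend_sub (hS i).2).symm
  · intro A₁ A₂ B h₁ h₂ hB
    have hc : Commute A₁.val A₂.val := commute_of_isStarNormal h₁ h₂ (hB ▸ B.normal)
    have := τ.isPartialVNMorphism_extend.val_eq_of_val_eq_lin (a := 1) hc
      (by rw [one_smul]; exact hB)
    rwa [one_smul] at this
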